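/- Let $X$ be a complex Banach space. For $\omega>0$ let $S_\omega:=\{z\in\mathbb C:|\operatorname{Im}z|<\omega\}$, and let $\Gamma_\omega:=\partial S_\omega=(i\omega+\mathbb R)\cup(-i\omega+\mathbb R)$ carry arc length measure. A closed linear operator $A$ on $X$ is of strip type $\omega_0\ge 0$ if its spectrum is contained in $\{|\operatorname{Im}z|\le\omega_0\}$ and, for every $\beta>\omega_0$, its resolvent $R(\lambda,A)=(\lambda-A)^{-1}$ is uniformly bounded on $\mathbb C\setminus S_\beta$. For a complex Hilbert space $H$ and a bounded operator $T:H\to X$ let $$\|T\|_\gamma:=\sup_F\Big(\mathbb E\Big\|\sum_{e\in F}\gamma_e\,Te\Big\|^2\Big)^{1/2},$$ where $F$ ranges over the finite orthonormal systems in $H$ and the $\gamma_e$ are independent complex standard Gaussian variables ($\gamma=\gamma_r+i\gamma_i$ with independent real standard Gaussians $\gamma_r,\gamma_i$). Let $\gamma(H;X)$ be the $\|\cdot\|_\gamma$-closure of the finite rank operators in $\{T:\|T\|_\gamma<\infty\}$. A strongly measurable function $u:\Gamma_\omega\to X$ belongs to $\gamma(L^2(\Gamma_\omega);X)$ if it is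 weakly $L^2$ and the operator $J_u:L^2(\Gamma_\omega)\to X$, $J_uh=\int_{\Gamma_\omega}h\,u$ (Pettis integral), lies in $\gamma(L^2(\Gamma_\omega);X)$; then $\|u\|_{\gamma(L^2(\Gamma_\omega);X)}:=\|J_u\|_\gamma$. **Theorem.** Let $A$ be a densely defined operator of strip type $\omega_0\ge0$ on $X$ and let $\omega>\omega_0$. Suppose that for every $x\in X$ the function $\lambda\mapsto R(\lambda,A)x$ belongs to $\gamma(L^2(\Gamma_\omega);X)$ and that there are constants $c,C>0$ with $$c\|x\|\le\|R(\lambda,A)x\|_{\gamma(L^2(\Gamma_\omega);X)}\le C\|x\|\qquad(x\in X).$$ Then $A$ has a bounded $H^\infty(S_\omega)$-calculus, i.e. there is a constant $C'\ge0$ such that $\|f(A)\|\le C'\sup_{z\in S_\omega}|f(z)|$ for every bounded holomorphic $f:S_\omega\to\mathbb C$ with $\int_{\mathbb R}|f(r+is)|\,dr<\infty$ for all $|s|<\omega$, where $$f(A):=\frac1{2\pi i}\int_{\partial S_\delta}f(z)R(z,A)\,dz$$ for any $\delta\in(\omega_0,\omega)$, with $\partial S_\delta$ positively oriented. -/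

import Mathlib

open MeasureTheory ProbabilityTheory Set
open scoped ENNReal

namespace StripCalculus

noncomputable section

/-! ### Resolvents of unbounded operators, operators of strip type -/

section Operators

variable {X : Type*} [NormedAddCommGroup X] [NormedSpace ℂ X]

/-- `R` is a bounded two-sided inverse of `z - A : dom A → X`. -/
def IsResolventAt (A : X →ₗ.[ℂ] X) (z : ℂ) (R : X →L[ℂ] X) : Prop :=
  (∀ y : X, ∃ hy : R y ∈ A.domain, z • R y - A ⟨R y, hy⟩ = y) ∧
    ∀ x : A.domain, R (z • (x : X) - A x) = x

theorem IsResolventAt.unique {A : X →ₗ.[ℂ] X} {z : ℂ} {R S : X →L[ℂ] X}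
    (hR : IsResolventAt A z R) (hS : IsResolventAt A z S) : R = S := by
  ext y
  obtain ⟨hy, e⟩ := hR.1 y
  have h := hS.2 ⟨R y, hy⟩
  simpa [e] using h.symm

/-- The resolvent set of an unbounded operator. -/
def resSet (A : X →ₗ.[ℂ] X) : Set ℂ := {z | ∃ R : X →L[ℂ] X, IsResolventAt A z R}

open Classical in
/-- The resolvent `R(z, A) = (z - A)⁻¹` for `z` in the resolvent set (and `0` elsewhere). -/
def res (A : X →ₗ.[ℂ] X) (z : ℂ) : X →L[ℂ] X :=
  if h : ∃ R : X →L[ℂ] X, IsResolventAt A z R then h.choose else 0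

theorem res_spec {A : X →ₗ.[ℂ] X} {z : ℂ} (hz : z ∈ resSet A) :
    IsResolventAt A z (res A z) := by
  have h : ∃ R : X →L[ℂ] X, IsResolventAt A z R := hz
  rw [res, dif_pos h]
  exact h.choose_spec

/-- The open horizontal strip `{z : |Im z| < ω}` (used for `ω > 0`). -/
def strip (ω : ℝ) : Set ℂ := {z | |z.im| < ω}

/-- `A` is closed, its spectrum lies in the closed strip `{|Im z| ≤ α}`, and for all `β > α` its
resolvent is uniformly bounded outside the open strip of height `β`. -/
structure IsStripType (A : X →ₗ.[ℂ] X) (α : ℝ) : Prop where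
  nonneg : 0 ≤ α
  isClosed : A.IsClosed
  spectrum_subset : (resSet A)ᶜ ⊆ {z : ℂ | |z.im| ≤ α}
  bounded : ∀ β : ℝ, α < β → ∃ M : ℝ, ∀ z : ℂ, z ∉ strip β → ‖res A z‖ ≤ M

end Operators

/-! ### The elementary calculus and bounded `H^∞`-calculus on a strip -/

section Calculus

/-- Elementary functions on the strip of height `ω`: bounded holomorphic functions that are
integrable along each horizontal line in the strip. -/
structure IsElementary (ω : ℝ) (f : ℂ → ℂ) : Prop where
  holo : DifferentiableOn ℂ f (strip ω)
  bdd : BddAbove ((fun z => ‖f z‖) '' strip ω)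
  integrable : ∀ s : ℝ, |s| < ω → Integrable (fun r : ℝ => f (r + s * Complex.I))

/-- The supremum norm of a bounded function on the strip of height `ω`. -/
def hinfNorm (ω : ℝ) (f : ℂ → ℂ) : ℝ := sSup ((fun z => ‖f z‖) '' strip ω)

variable {X : Type*} [NormedAddCommGroup X] [NormedSpace ℂ X]

/-- `(2πi)⁻¹ ∫_{∂ S_δ} f(z) R(z, A) dz`, where the boundary of the strip `S_δ` is positively
oriented: the lower line from left to right, the upper one from right to left. For `A` of strip
type `α`, `f` elementary on `S_ω` and `α < δ < ω` this is the operator `f(A)`. -/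
def contourCalc (A : X →ₗ.[ℂ] X) (δ : ℝ) (f : ℂ → ℂ) : X →L[ℂ] X :=
  (2 * (Real.pi : ℂ) * Complex.I)⁻¹ •
    ((∫ r : ℝ, f (r - δ * Complex.I) • res A (r - δ * Complex.I)) -
      ∫ r : ℝ, f (r + δ * Complex.I) • res A (r + δ * Complex.I))

/-- The operator `A` of strip type `α < ω` has a bounded `H^∞(S_ω)`-calculus: there is `C ≥ 0`
with `‖f(A)‖ ≤ C ‖f‖_∞` for all elementary `f` on `S_ω`; the contour `∂ S_δ` in the definition
of `f(A)` may be any one with `α < δ < ω`. -/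
def HasBoundedHinfCalculus (A : X →ₗ.[ℂ] X) (α ω : ℝ) : Prop :=
  ∃ C : ℝ, 0 ≤ C ∧ ∀ f : ℂ → ℂ, IsElementary ω f → ∀ δ : ℝ, α < δ → δ < ω →
    ‖contourCalc A δ f‖ ≤ C * hinfNorm ω f

end Calculus

/-! ### `γ`-radonifying operators -/

section Gamma

/-- The law of a complex standard Gaussian `γ = γ_r + i γ_i`, where `γ_r`, `γ_i` are independent
real standard Gaussians. -/
def complexStdGaussian : Measure ℂ :=
  ((gaussianReal 0 1).prod (gaussianReal 0 1)).map
    (fun p : ℝ × ℝ => (p.1 : ℂ) + (p.2 : ℂ) * Complex.I)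

variable {H : Type*} [NormedAddCommGroup H] [InnerProductSpace ℂ H]
variable {X : Type*} [NormedAddCommGroup X] [NormedSpace ℂ X]

/-- `(𝔼 ‖∑ᵢ γᵢ xᵢ‖²)^{1/2}` for independent complex standard Gaussians `γᵢ`. -/
def gaussianSumNorm {n : ℕ} (x : Fin n → X) : ℝ≥0∞ :=
  (∫⁻ g : Fin n → ℂ, ‖∑ i, g i • x i‖ₑ ^ 2 ∂(Measure.pi fun _ => complexStdGaussian)) ^ (1 / 2 : ℝ)

/-- The `γ`-norm of an operator: the supremum of the Gaussian sums over all finite orthonormal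
systems. -/
def gammaNorm (T : H →L[ℂ] X) : ℝ≥0∞ :=
  ⨆ (n : ℕ) (e : Fin n → H) (_ : Orthonormal ℂ e), gaussianSumNorm fun i => T (e i)

/-- `T ∈ γ(H; X)`: `T` is `γ`-summing and a limit in `γ`-norm of finite rank operators. -/
def IsGammaRadonifying (T : H →L[ℂ] X) : Prop :=
  gammaNorm T < ⊤ ∧ ∀ ε : ℝ≥0∞, 0 < ε →
    ∃ S : H →L[ℂ] X, FiniteDimensional ℂ (LinearMap.range (S : H →ₗ[ℂ] X)) ∧ gammaNorm (T - S) < ε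

variable {Ω : Type*} [MeasurableSpace Ω]

/-- `f` is strongly measurable and weakly `L²`. -/
def IsWeaklyL2 (f : Ω → X) (μ : Measure Ω) : Prop :=
  AEStronglyMeasurable f μ ∧ ∀ φ : X →L[ℂ] ℂ, MemLp (fun t => φ (f t)) 2 μ

/-- `T h` is the Pettis integral of `h f` for every `h ∈ L²`. -/
def IsPettisOperator (f : Ω → X) (μ : Measure Ω) (T : Lp ℂ 2 μ →L[ℂ] X) : Prop :=
  ∀ (h : Lp ℂ 2 μ) (φ : X →L[ℂ] ℂ), φ (T h) = ∫ t, h t * φ (f t) ∂μ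

theorem IsPettisOperator.unique {f : Ω → X} {μ : Measure Ω} {S T : Lp ℂ 2 μ →L[ℂ] X}
    (hS : IsPettisOperator f μ S) (hT : IsPettisOperator f μ T) : S = T := by
  ext h
  refine (SeparatingDual.eq_iff_forall_dual_eq (R := ℂ)).2 fun φ => ?_
  rw [hS h φ, hT h φ]

open Classical in
/-- The integration operator `L²(μ) → X`, `h ↦ ∫ h f dμ` (Pettis integral) of a weakly `L²`
function, if it exists (and `0` otherwise). -/
def pettisOperator (f : Ω → X) (μ : Measure Ω) : Lp ℂ 2 μ →L[ℂ] X :=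
  if h : ∃ T : Lp ℂ 2 μ →L[ℂ] X, IsPettisOperator f μ T then h.choose else 0

theorem pettisOperator_spec {f : Ω → X} {μ : Measure Ω}
    (h : ∃ T : Lp ℂ 2 μ →L[ℂ] X, IsPettisOperator f μ T) :
    IsPettisOperator f μ (pettisOperator f μ) := by
  rw [pettisOperator, dif_pos h]
  exact h.choose_spec

/-- `f ∈ γ(Ω; X)`: `f` is weakly `L²` and its integration operator is `γ`-radonifying. -/
def MemGamma (f : Ω → X) (μ : Measure Ω) : Prop :=
  IsWeaklyL2 f μ ∧ (∃ T : Lp ℂ 2 μ →L[ℂ] X, IsPettisOperator f μ T) ∧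
    IsGammaRadonifying (pettisOperator f μ)

/-- The norm `‖f‖_γ` of `f ∈ γ(Ω; X)`. -/
def gammaFunNorm (f : Ω → X) (μ : Measure Ω) : ℝ≥0∞ := gammaNorm (pettisOperator f μ)

end Gamma

/-- Arc length measure on `Γ_ω = ∂ S_ω = (iω + ℝ) ∪ (-iω + ℝ)`, `ω > 0`, as a measure on `ℂ`. -/
def stripBoundaryMeasure (ω : ℝ) : Measure ℂ :=
  (volume : Measure ℝ).map (fun s : ℝ => (s : ℂ) + ω * Complex.I) +
    (volume : Measure ℝ).map (fun s : ℝ => (s : ℂ) - ω * Complex.I)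

end

end StripCalculus

/-! The orbit `λ ↦ R(λ,A)x` on `Γ_ω` has γ-norm comparable to `‖x‖`, so bounding `F(A)` reduces to
bounding the orbit of `y = F(A)x` by that of `x`.

Let `F` be holomorphic with Gaussian decay on a strip of height `ω' > ω`, with `‖F‖ ≤ N`. For `l`
outside the closed strip of height `ω`, the resolvent identity and Cauchy's theorem give
`R(l,A)F(A)x = (2πi)⁻¹ ∫_{Γ_ω} F(z)/(l - z) R(z,A)x dz` (`IsStripType.res_contourCalc`). So on a
line just outside the strip, the orbit of `y` arises from the orbit of `x` by multiplication by `F`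
and Cauchy transforms between parallel lines. Such a transform is a Fourier multiplier whose symbol,
a one-sided exponential, is bounded by `2π` whatever the distance of the lines
(`exists_cauchyTransform`). The resulting `L²` operators are therefore bounded by `2N`, uniformly as
the outer line approaches `Γ_ω` (`IsStripType.exists_transference`).

On the γ side two facts suffice. The ideal property `γ(TS) ≤ ‖S‖ γ(T)` (`gaussianSumNorm_comp_le`)
rests on comparing Gaussian laws by their covariances, and lower semicontinuity
(`gaussianSumNorm_le_of_tendsto`) is Fatou's lemma. Adding the two lines of `Γ_ω` yields `γ(J_y) ≤
4N γ(J_x)`, hence `‖F(A)‖ ≤ (4C/c) N`.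

This constant does not depend on `ω'`. A general elementary `f` on the strip of height `ω` is
dilated to `f(z/s)` with `s > 1`, which lives on a larger strip, and multiplied by a Gaussian;
letting `s → 1` and the Gaussian tend to `1` preserves the bound. -/

namespace StripCalculus

/-! ### Covariance domination and the ideal property of the γ-norm -/

section GaussianComparison

open Complex in
theorem charFunDual_complexStdGaussian (L : StrongDual ℝ ℂ) :
    charFunDual complexStdGaussian L = exp (-((L 1 ^ 2 + L I ^ 2 : ℝ) : ℂ) / 2) := by
  have hL : ∀ a b : ℝ, L ((a : ℂ) + b * I) = a * L 1 + b * L I := by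
    intro a b
    have h1 : (a : ℂ) + b * I = a • (1 : ℂ) + b • I := by simp
    rw [h1, map_add, map_smul, map_smul, smul_eq_mul, smul_eq_mul]
  rw [charFunDual_apply, complexStdGaussian, integral_map (by fun_prop) (by fun_prop)]
  have h2 : ∀ p : ℝ × ℝ, exp (L ((p.1 : ℂ) + p.2 * I) * I) =
      exp ((L 1 : ℂ) * p.1 * I) * exp ((L I : ℂ) * p.2 * I) := by
    intro p
    rw [hL, ← exp_add]
    push_cast
    ring_nf
  simp_rw [h2]
  rw [integral_prod_mul (fun x : ℝ => exp ((L 1 : ℂ) * x * I))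
    (fun x : ℝ => exp ((L I : ℂ) * x * I)), ← charFun_apply_real, ← charFun_apply_real,
    charFun_gaussianReal, charFun_gaussianReal, ← exp_add]
  congr 1
  push_cast
  simp
  ring

instance : IsProbabilityMeasure complexStdGaussian :=
  Measure.isProbabilityMeasure_map (by fun_prop)

/-- The law of `n` independent complex standard Gaussians. -/
noncomputable abbrev gaussianPi (n : ℕ) : Measure (Fin n → ℂ) :=
  Measure.pi fun _ => complexStdGaussian

open Complex in
theorem charFunDual_gaussianPi {n : ℕ} (L : StrongDual ℝ (Fin n → ℂ)) :
    charFunDual (gaussianPi n) L =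
      exp (-((∑ i, (L (Pi.single i 1) ^ 2 + L (Pi.single i I) ^ 2) : ℝ) : ℂ) / 2) := by
  rw [charFunDual_pi]
  simp_rw [charFunDual_complexStdGaussian]
  rw [← exp_sum]
  congr 1
  simp only [ContinuousLinearMap.comp_apply, ContinuousLinearMap.single_apply]
  push_cast
  rw [← Finset.sum_div, Finset.sum_neg_distrib]

/-- The real-linear map `g ↦ (∑ᵢ gᵢ Aᵢⱼ)ⱼ`. -/
noncomputable def gaussianMap {n m : ℕ} (A : Matrix (Fin n) (Fin m) ℂ) :
    (Fin n → ℂ) →L[ℝ] (Fin m → ℂ) :=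
  LinearMap.toContinuousLinearMap (A.vecMulLinear.restrictScalars ℝ)

theorem gaussianMap_apply {n m : ℕ} (A : Matrix (Fin n) (Fin m) ℂ) (g : Fin n → ℂ) (j : Fin m) :
    gaussianMap A g j = ∑ i, g i * A i j := by
  simp [gaussianMap, Matrix.vecMul, dotProduct]

-- Characteristic functions are taken over real functionals, whereas the Gram forms compared below
-- are complex; viewing a real functional as the real part of a complex-linear one links the two.
open Complex in
theorem strongDual_eq_re {m : ℕ} (L : StrongDual ℝ (Fin m → ℂ)) (w : Fin m → ℂ) :
    L w = (∑ j, ((L (Pi.single j 1) : ℂ) - L (Pi.single j I) * I) * w j).re := by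
  have h : w = ∑ j, ((w j).re • (Pi.single j 1 : Fin m → ℂ) + (w j).im • (Pi.single j I : Fin m → ℂ)) := by
    ext k
    simp [Finset.sum_apply, Pi.single_apply, Finset.sum_add_distrib]
  conv_lhs => rw [h]
  rw [map_sum, re_sum]
  refine Finset.sum_congr rfl fun j _ => ?_
  rw [map_add, map_smul, map_smul]
  simp
  ring

open Complex in
theorem charFunDual_map_gaussianMap {n m : ℕ} (A : Matrix (Fin n) (Fin m) ℂ)
    (L : StrongDual ℝ (Fin m → ℂ)) :
    charFunDual ((gaussianPi n).map (gaussianMap A)) L =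
      exp (-((∑ i, ‖∑ j, ((L (Pi.single j 1) : ℂ) - L (Pi.single j I) * I) * A i j‖ ^ 2 : ℝ) : ℂ)
        / 2) := by
  rw [charFunDual_map, charFunDual_gaussianPi]
  congr 4
  refine Finset.sum_congr rfl fun i _ => ?_
  have h1 : gaussianMap A (Pi.single i 1) = fun j => A i j := by
    ext j; simp [gaussianMap_apply, Pi.single_apply]
  have h2 : gaussianMap A (Pi.single i I) = fun j => I * A i j := by
    ext j; simp [gaussianMap_apply, Pi.single_apply]
  rw [ContinuousLinearMap.comp_apply, ContinuousLinearMap.comp_apply, h1, h2,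
    strongDual_eq_re L, strongDual_eq_re L fun j => I * A i j, ← normSq_eq_norm_sq, normSq_apply]
  have h3 : ∑ j, ((L (Pi.single j 1) : ℂ) - L (Pi.single j I) * I) * (I * A i j) =
      I * ∑ j, ((L (Pi.single j 1) : ℂ) - L (Pi.single j I) * I) * A i j := by
    rw [Finset.mul_sum]
    exact Finset.sum_congr rfl fun j _ => by ring
  rw [h3, I_mul_re]
  ring

/-- A centred Gaussian law is determined by its covariance, and covariances add under convolution of
independent laws. -/
theorem map_gaussianMap_conv_eq {n m k l : ℕ} (A : Matrix (Fin n) (Fin m) ℂ)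
    (B : Matrix (Fin k) (Fin m) ℂ) (D : Matrix (Fin l) (Fin m) ℂ)
    (h : ∀ t : Fin m → ℂ, ∑ i, ‖∑ j, t j * A i j‖ ^ 2 + ∑ i, ‖∑ j, t j * B i j‖ ^ 2 =
      ∑ i, ‖∑ j, t j * D i j‖ ^ 2) :
    ((gaussianPi n).map (gaussianMap A)).conv ((gaussianPi k).map (gaussianMap B)) =
      (gaussianPi l).map (gaussianMap D) := by
  have := Measure.isProbabilityMeasure_map (μ := gaussianPi n) (gaussianMap A).measurable.aemeasurable
  have := Measure.isProbabilityMeasure_map (μ := gaussianPi k) (gaussianMap B).measurable.aemeasurable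
  have := Measure.isProbabilityMeasure_map (μ := gaussianPi l) (gaussianMap D).measurable.aemeasurable
  refine Measure.ext_of_charFunDual (funext fun L => ?_)
  rw [charFunDual_conv, charFunDual_map_gaussianMap, charFunDual_map_gaussianMap,
    charFunDual_map_gaussianMap, ← Complex.exp_add, ← h]
  congr 1
  push_cast
  ring

theorem map_neg_map_gaussianMap {n m : ℕ} (A : Matrix (Fin n) (Fin m) ℂ) :
    ((gaussianPi n).map (gaussianMap A)).map (fun x => -x) =
      (gaussianPi n).map (gaussianMap A) := by
  have h1 : ((gaussianPi n).map (gaussianMap A)).map (fun x => -x) =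
      (gaussianPi n).map (gaussianMap (-A)) := by
    rw [Measure.map_map measurable_neg (gaussianMap A).measurable]
    congr 1
    ext g j
    simp [gaussianMap_apply]
  have := Measure.isProbabilityMeasure_map (μ := gaussianPi n) (gaussianMap A).measurable.aemeasurable
  have := Measure.isProbabilityMeasure_map (μ := gaussianPi n)
    (gaussianMap (-A)).measurable.aemeasurable
  rw [h1]
  refine Measure.ext_of_charFunDual (funext fun L => ?_)
  rw [charFunDual_map_gaussianMap, charFunDual_map_gaussianMap]
  simp

/-- `Φ u` is the mean of `Φ (u + v)` and `Φ (u - v)`, so convexity of the squared norm applies; by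
symmetry of `ν` both terms have the same integral. Hence independent symmetric noise can only
increase second moments. -/
theorem enorm_sq_le_lintegral_of_symm {E X : Type*} [NormedAddCommGroup E] [NormedSpace ℝ E]
    [MeasurableSpace E] [BorelSpace E] [NormedAddCommGroup X] [NormedSpace ℝ X]
    (ν : Measure E) [IsProbabilityMeasure ν] (hν : ν.map (fun x => -x) = ν) (Φ : E →L[ℝ] X) (u : E) :
    ‖Φ u‖ₑ ^ 2 ≤ ∫⁻ v, ‖Φ (u + v)‖ₑ ^ 2 ∂ν := by
  have hm : Measurable fun v : E => ‖Φ (u + v)‖ₑ ^ 2 :=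
    Continuous.measurable (by fun_prop)
  have hsym : ∫⁻ v, ‖Φ (u + v)‖ₑ ^ 2 ∂ν = ∫⁻ v, ‖Φ (u - v)‖ₑ ^ 2 ∂ν := by
    conv_lhs => rw [← hν]
    rw [lintegral_map hm measurable_neg]
    simp_rw [sub_eq_add_neg]
  have key : ∀ v, 2 * ‖Φ u‖ₑ ^ 2 ≤ ‖Φ (u + v)‖ₑ ^ 2 + ‖Φ (u - v)‖ₑ ^ 2 := by
    intro v
    have h1 : 2 * ‖Φ u‖ ≤ ‖Φ (u + v)‖ + ‖Φ (u - v)‖ := by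
      have h2 : (2 : ℝ) • Φ u = Φ (u + v) + Φ (u - v) := by
        rw [map_add, map_sub, two_smul]; abel
      calc 2 * ‖Φ u‖ = ‖(2 : ℝ) • Φ u‖ := by rw [norm_smul]; simp
        _ ≤ _ := by rw [h2]; exact norm_add_le _ _
    have h3 : 2 * ‖Φ u‖ ^ 2 ≤ ‖Φ (u + v)‖ ^ 2 + ‖Φ (u - v)‖ ^ 2 := by
      nlinarith [norm_nonneg (Φ u), sq_nonneg (‖Φ (u + v)‖ - ‖Φ (u - v)‖)]
    have h4 := ENNReal.ofReal_le_ofReal h3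
    rw [ENNReal.ofReal_mul (by norm_num), ENNReal.ofReal_add (by positivity) (by positivity)] at h4
    simpa [ENNReal.ofReal_pow, ofReal_norm] using h4
  have h5 : 2 * ‖Φ u‖ₑ ^ 2 ≤ 2 * ∫⁻ v, ‖Φ (u + v)‖ₑ ^ 2 ∂ν := by
    calc 2 * ‖Φ u‖ₑ ^ 2 = ∫⁻ _, 2 * ‖Φ u‖ₑ ^ 2 ∂ν := by simp
      _ ≤ ∫⁻ v, (‖Φ (u + v)‖ₑ ^ 2 + ‖Φ (u - v)‖ₑ ^ 2) ∂ν := lintegral_mono key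
      _ = _ := by rw [lintegral_add_left hm, ← hsym, two_mul]
  exact (ENNReal.mul_le_mul_iff_right (by norm_num) (by norm_num)).1 h5

variable {X : Type*} [NormedAddCommGroup X] [NormedSpace ℂ X]

/-- The map `z ↦ ∑ⱼ zⱼ xⱼ`. -/
noncomputable def sumSMul {m : ℕ} (x : Fin m → X) : (Fin m → ℂ) →L[ℝ] X :=
  ∑ j, (((ContinuousLinearMap.proj (R := ℂ) (φ := fun _ : Fin m => ℂ) j).smulRight
    (x j)).restrictScalars ℝ)

theorem sumSMul_apply {m : ℕ} (x : Fin m → X) (z : Fin m → ℂ) : sumSMul x z = ∑ j, z j • x j := by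
  simp [sumSMul]

-- The Gaussian vector with coefficients `A` has covariance dominated by that of `K` times a
-- standard one. It becomes the latter in law after adding an independent Gaussian with the missing
-- covariance, and adding symmetric noise does not decrease the second moment.
open scoped ComplexOrder MatrixOrder Matrix.Norms.L2Operator in
theorem gaussianSumNorm_le_of_matrix {n m : ℕ} (A : Matrix (Fin n) (Fin m) ℂ) (K : ℝ) (hK : 0 ≤ K)
    (hA : ∀ t : Fin m → ℂ, ∑ i, ‖∑ j, t j * A i j‖ ^ 2 ≤ K ^ 2 * ∑ j, ‖t j‖ ^ 2) (x : Fin m → X) :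
    gaussianSumNorm (fun i => ∑ j, A i j • x j) ≤ ENNReal.ofReal K * gaussianSumNorm x := by
  classical
  have hn : ∀ {p : ℕ} (M : Matrix (Fin p) (Fin m) ℂ) (t : Fin m → ℂ),
      star t ⬝ᵥ (M.conjTranspose * M).mulVec t = ((∑ i, ‖∑ j, t j * M i j‖ ^ 2 : ℝ) : ℂ) := by
    intro p M t
    rw [← Matrix.mulVec_mulVec, Matrix.dotProduct_mulVec, Matrix.vecMul_conjTranspose, star_star]
    simp only [dotProduct, Pi.star_apply, Matrix.mulVec]
    push_cast
    refine Finset.sum_congr rfl fun i _ => ?_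
    rw [← Complex.conj_mul', Complex.star_def]
    simp_rw [mul_comm]
  set D : Matrix (Fin m) (Fin m) ℂ := Matrix.diagonal fun _ => (K : ℂ) with hD
  have hDt : ∀ t : Fin m → ℂ, ∑ i, ‖∑ j, t j * D i j‖ ^ 2 = K ^ 2 * ∑ j, ‖t j‖ ^ 2 := by
    intro t
    rw [Finset.mul_sum]
    refine Finset.sum_congr rfl fun i _ => ?_
    simp [hD, Matrix.diagonal_apply, mul_pow]
    ring
  have hpos : (D.conjTranspose * D - A.conjTranspose * A).PosSemidef := by
    refine Matrix.PosSemidef.of_dotProduct_mulVec_nonneg ?_ fun t => ?_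
    · exact (Matrix.isHermitian_conjTranspose_mul_self D).sub
        (Matrix.isHermitian_conjTranspose_mul_self A)
    · rw [Matrix.sub_mulVec, dotProduct_sub, hn, hn, ← Complex.ofReal_sub, hDt]
      exact_mod_cast sub_nonneg.2 (hA t)
  -- `B` carries the missing covariance: a factorization of the nonnegative matrix `K² - A*A`.
  obtain ⟨B, hB⟩ : ∃ B : Matrix (Fin m) (Fin m) ℂ,
      D.conjTranspose * D - A.conjTranspose * A = B.conjTranspose * B :=
    CStarAlgebra.nonneg_iff_eq_star_mul_self.mp hpos.nonneg
  have hlaw := map_gaussianMap_conv_eq A B D fun t => by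
    have := hn B t
    rw [← hB, Matrix.sub_mulVec, dotProduct_sub, hn, hn] at this
    have h2 : ∑ i, ‖∑ j, t j * D i j‖ ^ 2 - ∑ i, ‖∑ j, t j * A i j‖ ^ 2 =
      ∑ i, ‖∑ j, t j * B i j‖ ^ 2 := by exact_mod_cast this
    linarith
  have := Measure.isProbabilityMeasure_map (μ := gaussianPi m)
    (gaussianMap B).measurable.aemeasurable
  have := Measure.isProbabilityMeasure_map (μ := gaussianPi n)
    (gaussianMap A).measurable.aemeasurable
  have hm : Measurable fun z : Fin m → ℂ => ‖sumSMul x z‖ₑ ^ 2 :=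
    Continuous.measurable (by fun_prop)
  have hle : ∫⁻ g, ‖sumSMul x (gaussianMap A g)‖ₑ ^ 2 ∂(gaussianPi n) ≤
      ∫⁻ g, ‖sumSMul x (gaussianMap D g)‖ₑ ^ 2 ∂(gaussianPi m) := by
    rw [← lintegral_map hm (gaussianMap A).measurable,
      ← lintegral_map hm (gaussianMap D).measurable, ← hlaw, Measure.lintegral_conv hm]
    exact lintegral_mono fun u => enorm_sq_le_lintegral_of_symm _ (map_neg_map_gaussianMap B) _ u
  have hAx : ∀ g, ∑ i, g i • (∑ j, A i j • x j) = sumSMul x (gaussianMap A g) := by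
    intro g
    rw [sumSMul_apply]
    simp_rw [gaussianMap_apply, Finset.sum_smul, Finset.smul_sum, smul_smul]
    exact Finset.sum_comm
  have hDx : ∀ g, ‖sumSMul x (gaussianMap D g)‖ₑ ^ 2 =
      ENNReal.ofReal K ^ 2 * ‖∑ i, g i • x i‖ₑ ^ 2 := by
    intro g
    have : gaussianMap D g = K • g := by
      ext j
      simp [gaussianMap_apply, hD, Matrix.diagonal_apply, mul_comm]
    rw [this, map_smul, sumSMul_apply, enorm_smul, mul_pow, Real.enorm_of_nonneg hK]
  simp_rw [hDx] at hle
  rw [lintegral_const_mul' _ _ (by finiteness)] at hle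
  unfold gaussianSumNorm
  simp_rw [hAx]
  refine (ENNReal.rpow_le_rpow hle (by norm_num)).trans (le_of_eq ?_)
  rw [ENNReal.mul_rpow_of_nonneg _ _ (by norm_num), ← ENNReal.rpow_natCast, ← ENNReal.rpow_mul]
  norm_num

variable {H H' : Type*} [NormedAddCommGroup H] [InnerProductSpace ℂ H] [CompleteSpace H]
  [NormedAddCommGroup H'] [InnerProductSpace ℂ H'] [CompleteSpace H']

/-- The vectors `S (e i)` span a finite-dimensional space, whose orthonormal basis is an admissible
system for `gammaNorm T`. The coefficient matrix in this basis inherits the bound `K` from `S`. -/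
theorem gaussianSumNorm_comp_le (S : H →L[ℂ] H') (T : H' →L[ℂ] X) {K : ℝ} (hK : ‖S‖ ≤ K)
    {n : ℕ} {e : Fin n → H} (he : Orthonormal ℂ e) :
    gaussianSumNorm (fun i => T (S (e i))) ≤ ENNReal.ofReal K * gammaNorm T := by
  let V : Submodule ℂ H' := Submodule.span ℂ (Set.range fun i => S (e i))
  have : FiniteDimensional ℂ V := FiniteDimensional.span_of_finite ℂ (Set.finite_range _)
  let b := stdOrthonormalBasis ℂ V
  set m := Module.finrank ℂ V
  have hmem : ∀ i, S (e i) ∈ V := fun i => Submodule.subset_span (Set.mem_range_self i)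
  let A : Matrix (Fin n) (Fin m) ℂ := fun i j => inner ℂ (b j : H') (S (e i))
  have hbo : Orthonormal ℂ fun j => (b j : H') :=
    b.orthonormal.comp_linearIsometry V.subtypeₗᵢ
  have hexp : ∀ i, S (e i) = ∑ j, A i j • (b j : H') := by
    intro i
    have := b.sum_repr' ⟨S (e i), hmem i⟩
    have h2 := congrArg (Subtype.val) this
    simp only [Submodule.coe_sum, Submodule.coe_smul, Submodule.coe_inner] at h2
    exact h2.symm
  have hK0 : 0 ≤ K := (norm_nonneg _).trans hK
  have hA : ∀ t : Fin m → ℂ, ∑ i, ‖∑ j, t j * A i j‖ ^ 2 ≤ K ^ 2 * ∑ j, ‖t j‖ ^ 2 := by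
    intro t
    -- The matrix bound is Bessel's inequality for `S.adjoint v` along `e`; the coefficients are
    -- conjugated because the inner product is conjugate-linear in its first slot.
    set v : H' := ∑ j, (starRingEnd ℂ (t j)) • (b j : H') with hv
    have h1 : ∀ i, ‖∑ j, t j * A i j‖ = ‖inner ℂ (e i) (S.adjoint v)‖ := by
      intro i
      rw [ContinuousLinearMap.adjoint_inner_right, ← inner_conj_symm, RCLike.norm_conj, hv,
        sum_inner]
      simp [inner_smul_left, A]
    simp_rw [h1]
    refine (he.sum_inner_products_le (S.adjoint v)).trans ?_
    have h2 : ‖v‖ ^ 2 = ∑ j, ‖t j‖ ^ 2 := by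
      have := hbo.inner_sum (fun j => starRingEnd ℂ (t j)) (fun j => starRingEnd ℂ (t j)) Finset.univ
      rw [← hv, inner_self_eq_norm_sq_to_K] at this
      have h3 : ((‖v‖ ^ 2 : ℝ) : ℂ) = ((∑ j, ‖t j‖ ^ 2 : ℝ) : ℂ) := by
        push_cast
        rw [show ((‖v‖ : ℂ)) ^ 2 = _ from this]
        refine Finset.sum_congr rfl fun j _ => ?_
        rw [Complex.conj_conj, Complex.mul_conj']
      exact_mod_cast h3
    rw [← h2, ← mul_pow]
    have h3 : ‖S.adjoint v‖ ≤ K * ‖v‖ := by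
      refine (S.adjoint.le_opNorm v).trans ?_
      rw [LinearIsometryEquiv.norm_map]
      gcongr
    gcongr
  have h := gaussianSumNorm_le_of_matrix A K hK0 hA fun j => T (b j)
  have h2 : (fun i => T (S (e i))) = fun i => ∑ j, A i j • T (b j) := by
    ext i
    rw [hexp i, map_sum]
    simp
  rw [h2]
  refine h.trans ?_
  gcongr
  exact le_iSup₂_of_le m (fun j => (b j : H')) (le_iSup_of_le hbo le_rfl)

/-- Lower semicontinuity of Gaussian sums. -/
theorem gaussianSumNorm_le_of_tendsto {n : ℕ} {x : ℕ → Fin n → X} {y : Fin n → X} {K : ℝ≥0∞}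
    (hx : ∀ i, Filter.Tendsto (fun k => x k i) Filter.atTop (nhds (y i)))
    (hK : ∀ k, gaussianSumNorm (x k) ≤ K) : gaussianSumNorm y ≤ K := by
  have h1 : ∀ z : Fin n → X, ∀ M : ℝ≥0∞, gaussianSumNorm z ≤ M ↔
      ∫⁻ g, ‖∑ i, g i • z i‖ₑ ^ 2 ∂(gaussianPi n) ≤ M ^ (2 : ℝ) := by
    intro z M
    rw [gaussianSumNorm, ← ENNReal.rpow_le_rpow_iff (z := 2) (by norm_num), ← ENNReal.rpow_mul]
    norm_num
  rw [h1]
  have hlim : ∀ g : Fin n → ℂ, Filter.Tendsto (fun k => ‖∑ i, g i • x k i‖ₑ ^ 2) Filter.atTop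
      (nhds (‖∑ i, g i • y i‖ₑ ^ 2)) := by
    intro g
    have : Continuous fun w : X => ‖w‖ₑ ^ 2 := by fun_prop
    exact (this.tendsto _).comp (tendsto_finsetSum _ fun i _ => (hx i).const_smul (g i))
  have hm : ∀ z : Fin n → X, Measurable fun g : Fin n → ℂ => ‖∑ i, g i • z i‖ₑ ^ 2 :=
    fun z => Continuous.measurable (by fun_prop)
  calc ∫⁻ g, ‖∑ i, g i • y i‖ₑ ^ 2 ∂(gaussianPi n)
      = ∫⁻ g, Filter.liminf (fun k => ‖∑ i, g i • x k i‖ₑ ^ 2) Filter.atTop ∂(gaussianPi n) :=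
        lintegral_congr fun g => (hlim g).liminf_eq.symm
    _ ≤ Filter.liminf (fun k => ∫⁻ g, ‖∑ i, g i • x k i‖ₑ ^ 2 ∂(gaussianPi n)) Filter.atTop :=
        lintegral_liminf_le fun k => hm _
    _ ≤ K ^ (2 : ℝ) := Filter.liminf_le_of_le (by isBoundedDefault) fun b hb => by
        obtain ⟨k, hk⟩ := hb.exists
        exact hk.trans ((h1 _ _).1 (hK k))

end GaussianComparison

/-! ### Resolvent identity and holomorphy of the resolvent -/

section Resolvent

variable {X : Type*} [NormedAddCommGroup X] [NormedSpace ℂ X] {A : X →ₗ.[ℂ] X} {α : ℝ}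

theorem res_sub_res {z w : ℂ} (hz : z ∈ resSet A) (hw : w ∈ resSet A) :
    res A z - res A w = (w - z) • (res A z).comp (res A w) := by
  ext y
  obtain ⟨hy, e⟩ := (res_spec hw).1 y
  have h := (res_spec hz).2 ⟨res A w y, hy⟩
  have h2 : z • res A w y - A ⟨res A w y, hy⟩ = (z - w) • res A w y + y := by
    linear_combination (norm := module) e
  simp only at h
  rw [h2, map_add, map_smul] at h
  simp only [sub_apply, smul_apply,
    ContinuousLinearMap.comp_apply]
  linear_combination (norm := module) h

theorem IsStripType.mem_resSet (hA : IsStripType A α) {z : ℂ} (hz : α < |z.im|) :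
    z ∈ resSet A := by
  by_contra h
  exact absurd (hA.spectrum_subset h) (not_le.2 hz)

theorem IsStripType.exists_bound (hA : IsStripType A α) {β : ℝ} (hβ : α < β) :
    ∃ M : ℝ, 0 ≤ M ∧ ∀ z : ℂ, β ≤ |z.im| → ‖res A z‖ ≤ M := by
  obtain ⟨M, hM⟩ := hA.bounded β hβ
  refine ⟨max M 0, le_max_right _ _, fun z hz => (hM z ?_).trans (le_max_left _ _)⟩
  simpa [strip] using hz

theorem IsStripType.eventually_im (_ : IsStripType A α) {z : ℂ} {β : ℝ} (hβ : β < |z.im|) :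
    ∀ᶠ w in nhds z, β < |w.im| :=
  (Complex.continuous_im.abs.tendsto z).eventually (lt_mem_nhds hβ)

theorem IsStripType.continuousAt_res (hA : IsStripType A α) {z : ℂ} (hz : α < |z.im|) :
    ContinuousAt (res A) z := by
  obtain ⟨β, hβ, hβz⟩ := exists_between hz
  obtain ⟨M, hM0, hM⟩ := hA.exists_bound hβ
  rw [ContinuousAt, tendsto_iff_norm_sub_tendsto_zero]
  have h0 : Filter.Tendsto (fun w => ‖z - w‖ * (M * M)) (nhds z) (nhds 0) := by
    have : Continuous fun w : ℂ => ‖z - w‖ * (M * M) := by fun_prop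
    simpa using this.tendsto z
  refine squeeze_zero' (Filter.Eventually.of_forall fun _ => norm_nonneg _) ?_ h0
  filter_upwards [hA.eventually_im hβz] with w hw
  rw [res_sub_res (hA.mem_resSet (hβ.trans hw)) (hA.mem_resSet hz), norm_smul]
  gcongr
  refine (ContinuousLinearMap.opNorm_comp_le _ _).trans ?_
  gcongr
  · exact hM w hw.le
  · exact hM z hβz.le

theorem IsStripType.hasDerivAt_res (hA : IsStripType A α) {z : ℂ} (hz : α < |z.im|) :
    HasDerivAt (res A) (-(res A z).comp (res A z)) z := by
  rw [hasDerivAt_iff_tendsto_slope]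
  have h1 : Filter.Tendsto (fun w => -(res A w).comp (res A z)) (nhdsWithin z {z}ᶜ)
      (nhds (-(res A z).comp (res A z))) := by
    have : ContinuousAt (fun w => -(res A w).comp (res A z)) z :=
      ((hA.continuousAt_res hz).clm_comp continuousAt_const).neg
    exact this.tendsto.mono_left nhdsWithin_le_nhds
  refine h1.congr' ?_
  filter_upwards [nhdsWithin_le_nhds (hA.eventually_im hz), self_mem_nhdsWithin] with w hw hne
  have hne' : w - z ≠ 0 := sub_ne_zero.2 hne
  rw [slope_def_module, res_sub_res (hA.mem_resSet hw) (hA.mem_resSet hz), smul_smul,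
    ← neg_sub w z, mul_neg, inv_mul_cancel₀ hne', neg_one_smul]

theorem IsStripType.differentiableAt_res (hA : IsStripType A α) {z : ℂ} (hz : α < |z.im|) :
    DifferentiableAt ℂ (res A) z := (hA.hasDerivAt_res hz).differentiableAt

end Resolvent

/-! ### Shifting horizontal lines of integration -/

section LineShift

theorem integrable_of_gaussian_bound {E : Type*} [NormedAddCommGroup E] {g : ℝ → E} (hg : Continuous g) {B b : ℝ} (hb : 0 < b)
    (h : ∀ r, ‖g r‖ ≤ B * Real.exp (-b * r ^ 2)) : Integrable g :=
  ((integrable_exp_neg_mul_sq hb).const_mul B).mono' hg.aestronglyMeasurable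
    (Filter.Eventually.of_forall h)

/-- Cauchy's theorem on a horizontal strip. -/
theorem integral_line_eq_integral_line {E : Type*} [NormedAddCommGroup E] [NormedSpace ℂ E]
    [CompleteSpace E] {g : ℂ → E} {a c : ℝ} (hac : a ≤ c)
    (hd : ∀ z : ℂ, a ≤ z.im → z.im ≤ c → DifferentiableAt ℂ g z) {B b : ℝ} (hb : 0 < b)
    (h : ∀ z : ℂ, a ≤ z.im → z.im ≤ c → ‖g z‖ ≤ B * Real.exp (-b * z.re ^ 2)) :
    ∫ r : ℝ, g (r + a * Complex.I) = ∫ r : ℝ, g (r + c * Complex.I) := by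
  have hint : ∀ s : ℝ, a ≤ s → s ≤ c → Integrable fun r : ℝ => g (r + s * Complex.I) := by
    intro s has hsc
    refine integrable_of_gaussian_bound (B := B) (b := b) ?_ hb fun r => ?_
    · refine continuous_iff_continuousAt.2 fun r => ?_
      have h1 : ContinuousAt g (r + s * Complex.I) :=
        (hd _ (by simpa using has) (by simpa using hsc)).continuousAt
      exact ContinuousAt.comp (f := fun r : ℝ => (r : ℂ) + s * Complex.I) h1 (by fun_prop)
    · simpa using h (r + s * Complex.I) (by simpa using has) (by simpa using hsc)
  have hT : Filter.Tendsto (fun T : ℝ => T) Filter.atTop Filter.atTop := Filter.tendsto_id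
  have hT' : Filter.Tendsto (fun T : ℝ => -T) Filter.atTop Filter.atBot :=
    Filter.tendsto_neg_atTop_atBot
  have la := intervalIntegral_tendsto_integral (hint a le_rfl hac) hT' hT
  have lc := intervalIntegral_tendsto_integral (hint c hac le_rfl) hT' hT
  -- This bound for the vertical sides of the rectangle decays because the height `c - a` stays
  -- fixed.
  have hexp : Filter.Tendsto (fun T : ℝ => B * Real.exp (-b * T ^ 2) * |c - a|) Filter.atTop
      (nhds 0) := by
    have h1 : Filter.Tendsto (fun T : ℝ => b * T ^ 2) Filter.atTop Filter.atTop :=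
      (Filter.tendsto_pow_atTop two_ne_zero).const_mul_atTop hb
    have h2 := ((Real.tendsto_exp_neg_atTop_nhds_zero.comp h1).const_mul B).mul_const |c - a|
    simpa [Function.comp_def] using h2
  have hv : ∀ T : ℝ, ‖∫ y : ℝ in a..c, g (T + y * Complex.I)‖ ≤
      B * Real.exp (-b * T ^ 2) * |c - a| := by
    intro T
    refine intervalIntegral.norm_integral_le_of_norm_le_const fun y hy => ?_
    rw [Set.uIoc_of_le hac] at hy
    simpa using h (T + y * Complex.I) (by simpa using hy.1.le) (by simpa using hy.2)
  have lr : Filter.Tendsto (fun T : ℝ => ∫ y : ℝ in a..c, g (T + y * Complex.I)) Filter.atTop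
      (nhds 0) := squeeze_zero_norm hv hexp
  have ll : Filter.Tendsto (fun T : ℝ => ∫ y : ℝ in a..c, g ((-T : ℝ) + y * Complex.I))
      Filter.atTop (nhds 0) := squeeze_zero_norm (fun T => by simpa using hv (-T)) hexp
  have hrect : ∀ T : ℝ, (((∫ x : ℝ in (-T)..T, g (x + a * Complex.I)) -
      ∫ x : ℝ in (-T)..T, g (x + c * Complex.I)) +
      Complex.I • ∫ y : ℝ in a..c, g (T + y * Complex.I)) -
      Complex.I • ∫ y : ℝ in a..c, g ((-T : ℝ) + y * Complex.I) = 0 := by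
    intro T
    have := Complex.integral_boundary_rect_eq_zero_of_differentiableOn g
      ((-T : ℝ) + a * Complex.I) (T + c * Complex.I) (fun z hz => by
        have him := (Complex.mem_reProdIm.1 hz).2
        simp only [Complex.add_im, Complex.ofReal_im, Complex.mul_im, Complex.ofReal_re,
          Complex.I_im, Complex.I_re, mul_one, mul_zero, add_zero, zero_add,
          Set.uIcc_of_le hac] at him
        exact (hd z him.1 him.2).differentiableWithinAt)
    simpa using this
  have hlim := ((la.sub lc).add (lr.const_smul Complex.I)).sub (ll.const_smul Complex.I)
  simp only [hrect, smul_zero, add_zero, sub_zero] at hlim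
  exact sub_eq_zero.1 (tendsto_nhds_unique hlim tendsto_const_nhds)

end LineShift

/-! ### Contour integrals and the resolvent of `F(A)x` -/

section Contour

/-- Holomorphic functions on a strip with Gaussian decay at infinity. -/
structure IsGaussianDecaying (ω : ℝ) (F : ℂ → ℂ) : Prop where
  holo : DifferentiableOn ℂ F (strip ω)
  decay : ∃ B b : ℝ, 0 ≤ B ∧ 0 < b ∧ ∀ z ∈ strip ω, ‖F z‖ ≤ B * Real.exp (-b * z.re ^ 2)

theorem isOpen_strip (ω : ℝ) : IsOpen (strip ω) :=
  isOpen_lt Complex.continuous_im.abs continuous_const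

theorem IsGaussianDecaying.differentiableAt {ω : ℝ} {F : ℂ → ℂ} (hF : IsGaussianDecaying ω F)
    {z : ℂ} (hz : |z.im| < ω) : DifferentiableAt ℂ F z :=
  hF.holo.differentiableAt ((isOpen_strip ω).mem_nhds hz)

theorem IsGaussianDecaying.continuous_line {ω : ℝ} {F : ℂ → ℂ} (hF : IsGaussianDecaying ω F)
    {s : ℝ} (hs : |s| < ω) : Continuous fun r : ℝ => F (r + s * Complex.I) := by
  refine continuous_iff_continuousAt.2 fun r => ?_
  have h1 : ContinuousAt F (r + s * Complex.I) :=
    (hF.differentiableAt (by simpa using hs)).continuousAt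
  exact ContinuousAt.comp (f := fun r : ℝ => (r : ℂ) + s * Complex.I) h1 (by fun_prop)

theorem IsGaussianDecaying.integrable_line {ω : ℝ} {F : ℂ → ℂ} (hF : IsGaussianDecaying ω F)
    {s : ℝ} (hs : |s| < ω) : Integrable fun r : ℝ => F (r + s * Complex.I) := by
  obtain ⟨B, b, hB, hb, h⟩ := hF.decay
  refine integrable_of_gaussian_bound (B := B) (hF.continuous_line hs) hb fun r => ?_
  simpa using h (r + s * Complex.I) (by simpa [strip] using hs)

variable {X : Type*} [NormedAddCommGroup X] [NormedSpace ℂ X] {A : X →ₗ.[ℂ] X} {α : ℝ}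

theorem IsStripType.continuous_res_line (hA : IsStripType A α) {s : ℝ} (hs : α < |s|) :
    Continuous fun r : ℝ => res A (r + s * Complex.I) := by
  refine continuous_iff_continuousAt.2 fun r => ?_
  have h1 : ContinuousAt (res A) (r + s * Complex.I) :=
    hA.continuousAt_res (by simpa using hs)
  exact ContinuousAt.comp (f := fun r : ℝ => (r : ℂ) + s * Complex.I) h1 (by fun_prop)

theorem contourCalc_eq_lines (A : X →ₗ.[ℂ] X) (δ : ℝ) (f : ℂ → ℂ) :
    contourCalc A δ f = (2 * (Real.pi : ℂ) * Complex.I)⁻¹ •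
    ((∫ r : ℝ, f (r + (-δ : ℝ) * Complex.I) • res A (r + (-δ : ℝ) * Complex.I)) -
      ∫ r : ℝ, f (r + δ * Complex.I) • res A (r + δ * Complex.I)) := by
  rw [contourCalc]
  simp only [Complex.ofReal_neg, neg_mul, sub_eq_add_neg]

theorem IsStripType.integrable_smul_res (hA : IsStripType A α) {s : ℝ} (hs : α < |s|)
    {f : ℝ → ℂ} (hf : Integrable f) :
    Integrable fun r : ℝ => f r • res A (r + s * Complex.I) := by
  obtain ⟨M, hM0, hM⟩ := hA.exists_bound hs
  exact hf.smul_bdd M (hA.continuous_res_line hs).aestronglyMeasurable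
    (Filter.Eventually.of_forall fun r => hM _ (by simp))

theorem IsStripType.contourCalc_eq [CompleteSpace X] (hA : IsStripType A α) {ω : ℝ} {F : ℂ → ℂ}
    (hF : IsGaussianDecaying ω F) {δ ε : ℝ} (hδ : α < δ) (hδε : δ ≤ ε) (hε : ε < ω) :
    contourCalc A δ F = contourCalc A ε F := by
  obtain ⟨B, b, hB, hb, h⟩ := hF.decay
  obtain ⟨M, hM0, hM⟩ := hA.exists_bound hδ
  have h0 : 0 ≤ α := hA.nonneg
  -- The upper and the lower line move separately. While moving, their distance to the real axis
  -- stays in `[δ, ε]`, so they never meet the spectrum nor leave the domain of `F`.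
  have key : ∀ a c : ℝ, a ≤ c → (∀ s, a ≤ s → s ≤ c → δ ≤ |s| ∧ |s| ≤ ε) →
      ∫ r : ℝ, F (r + a * Complex.I) • res A (r + a * Complex.I) =
      ∫ r : ℝ, F (r + c * Complex.I) • res A (r + c * Complex.I) := by
    intro a c hac hs
    refine integral_line_eq_integral_line (g := fun z => F z • res A z) hac (fun z h1 h2 => ?_) hb
      (B := B * M) fun z h1 h2 => ?_
    · exact (hF.differentiableAt ((hs _ h1 h2).2.trans_lt hε)).smul
        (hA.differentiableAt_res (hδ.trans_le (hs _ h1 h2).1))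
    · rw [norm_smul, mul_right_comm]
      exact mul_le_mul (h z ((hs _ h1 h2).2.trans_lt hε)) (hM z (hs _ h1 h2).1) (norm_nonneg _)
        (by positivity)
  rw [contourCalc_eq_lines, contourCalc_eq_lines,
    key δ ε hδε fun s h1 h2 => ?_, key (-ε) (-δ) (by linarith) fun s h1 h2 => ?_]
  · rw [abs_of_nonpos (by linarith)]
    constructor <;> linarith
  · rw [abs_of_nonneg (by linarith)]
    exact ⟨h1, h2⟩

/-- The resolvent identity integrated over the contour. -/
theorem IsStripType.res_contourCalc [CompleteSpace X] (hA : IsStripType A α) {ω ω' : ℝ} {F : ℂ → ℂ}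
    (hF : IsGaussianDecaying ω' F) (hω : α < ω) (hω' : ω < ω') {l : ℂ} (hl : ω < |l.im|) (x : X) :
    res A l (contourCalc A ω F x) = (2 * (Real.pi : ℂ) * Complex.I)⁻¹ •
    ((∫ s : ℝ, (F (s + (-ω : ℝ) * Complex.I) / (l - (s + (-ω : ℝ) * Complex.I))) •
        res A (s + (-ω : ℝ) * Complex.I) x) -
      ∫ s : ℝ, (F (s + ω * Complex.I) / (l - (s + ω * Complex.I))) •
        res A (s + ω * Complex.I) x) := by
  have h0 : 0 < ω := hA.nonneg.trans_lt hω
  obtain ⟨B, b, hB, hb, h⟩ := hF.decay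
  have hdist : ∀ z : ℂ, |z.im| ≤ ω → |l.im| - ω ≤ ‖l - z‖ := by
    intro z hz
    have h1 := Complex.abs_im_le_norm (l - z)
    rw [Complex.sub_im] at h1
    have h2 := abs_sub_abs_le_abs_sub l.im z.im
    linarith
  have hne : ∀ z : ℂ, |z.im| ≤ ω → l - z ≠ 0 := fun z hz =>
    norm_pos_iff.1 ((sub_pos.2 hl).trans_le (hdist z hz))
  have hdecay : ∀ z : ℂ, |z.im| ≤ ω →
      ‖F z / (l - z)‖ ≤ B / (|l.im| - ω) * Real.exp (-b * z.re ^ 2) := by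
    intro z hz
    rw [norm_div, div_mul_eq_mul_div]
    have h1 := sub_pos.2 hl
    have h2 := hdist z hz
    gcongr
    exact h z (hz.trans_lt hω')
  have hdiff : ∀ z : ℂ, |z.im| ≤ ω → DifferentiableAt ℂ (fun z => F z / (l - z)) z := fun z hz =>
    (hF.differentiableAt (hz.trans_lt hω')).div (by fun_prop) (hne z hz)
  -- As `l` lies outside the closed strip there is no pole between the two lines; this later cancels
  -- the multiples of `R(l,A)x`.
  have hcauchy : ∫ s : ℝ, F (s + (-ω : ℝ) * Complex.I) / (l - (s + (-ω : ℝ) * Complex.I)) =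
      ∫ s : ℝ, F (s + ω * Complex.I) / (l - (s + ω * Complex.I)) :=
    integral_line_eq_integral_line (g := fun z => F z / (l - z)) (by linarith)
      (fun z h1 h2 => hdiff z (abs_le.2 ⟨h1, h2⟩)) hb fun z h1 h2 => hdecay z (abs_le.2 ⟨h1, h2⟩)
  -- The resolvent identity in the form `R(l)R(z) = (R(z) - R(l)) / (l - z)`, integrated along one
  -- line.
  have hline : ∀ σ : ℝ, |σ| = ω →
      res A l ((∫ s : ℝ, F (s + σ * Complex.I) • res A (s + σ * Complex.I)) x) =
      (∫ s : ℝ, (F (s + σ * Complex.I) / (l - (s + σ * Complex.I))) • res A (s + σ * Complex.I) x) -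
      (∫ s : ℝ, F (s + σ * Complex.I) / (l - (s + σ * Complex.I))) • res A l x := by
    intro σ hσ
    have him : ∀ s : ℝ, |((s : ℂ) + σ * Complex.I).im| = ω := fun s => by simpa using hσ
    have hi := hF.integrable_line (s := σ) (by rw [hσ]; exact hω')
    have hi2 := hA.integrable_smul_res (s := σ) (by rw [hσ]; exact hω) hi
    have hq : Integrable fun s : ℝ => F (s + σ * Complex.I) / (l - (s + σ * Complex.I)) := by
      refine integrable_of_gaussian_bound (B := B / (|l.im| - ω)) ?_ hb fun r => ?_
      · refine continuous_iff_continuousAt.2 fun r => ?_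
        have h1 := (hdiff (r + σ * Complex.I) (him r).le).continuousAt
        exact ContinuousAt.comp (f := fun r : ℝ => (r : ℂ) + σ * Complex.I) h1 (by fun_prop)
      · simpa using hdecay (r + σ * Complex.I) (him r).le
    have hq2 : Integrable fun s : ℝ => (F (s + σ * Complex.I) / (l - (s + σ * Complex.I))) •
        res A (s + σ * Complex.I) x := (hA.integrable_smul_res (s := σ) (by rw [hσ]; exact hω) hq).apply_continuousLinearMap x
    rw [ContinuousLinearMap.integral_apply hi2,
      ← ContinuousLinearMap.integral_comp_comm _ (hi2.apply_continuousLinearMap x),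
      ← integral_smul_const, ← integral_sub hq2 (hq.smul_const _)]
    refine integral_congr_ae (Filter.Eventually.of_forall fun s => ?_)
    have h1 := congrArg (fun T : X →L[ℂ] X => T x) (res_sub_res (A := A)
      (hA.mem_resSet (hω.trans hl)) (hA.mem_resSet (z := s + σ * Complex.I) (by rw [him]; exact hω)))
    have hne' := hne (s + σ * Complex.I) (him s).le
    simp only [sub_apply, smul_apply,
      ContinuousLinearMap.comp_apply, map_smul] at h1 ⊢
    rw [← smul_sub, div_eq_mul_inv, mul_smul]
    congr 1
    rw [eq_inv_smul_iff₀ hne']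
    linear_combination (norm := module) h1
  rw [contourCalc_eq_lines, smul_apply, sub_apply, map_smul,
    map_sub, hline (-ω) (by rw [abs_neg, abs_of_pos h0]), hline ω (abs_of_pos h0), hcauchy]
  congr 1
  abel

end Contour

/-! ### The Cauchy transform between parallel lines on `L²` -/

section CauchyTransform

open scoped FourierTransform SchwartzMap

/-- Multiplication by a bounded function as an operator on `L²`. -/
theorem exists_mulOp {Ω : Type*} [MeasurableSpace Ω] {μ : Measure Ω} {m : Ω → ℂ}
    (hm : AEStronglyMeasurable m μ) {K : ℝ} (hK : 0 ≤ K) (hb : ∀ᵐ t ∂μ, ‖m t‖ ≤ K) :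
    ∃ M : Lp ℂ 2 μ →L[ℂ] Lp ℂ 2 μ, ‖M‖ ≤ K ∧ ∀ h, M h =ᵐ[μ] fun t => m t * h t := by
  have hmem : MemLp m ∞ μ := memLp_top_of_bound hm K hb
  refine ⟨(ContinuousLinearMap.mul ℂ ℂ).holderL μ ∞ 2 2 (hmem.toLp m), ?_, fun h => ?_⟩
  · refine (ContinuousLinearMap.le_opNorm _ _).trans ?_
    have h1 : ‖(ContinuousLinearMap.mul ℂ ℂ).holderL μ ∞ 2 2‖ ≤ 1 :=
      (ContinuousLinearMap.norm_holderL_le _).trans (ContinuousLinearMap.opNorm_mul_le ℂ ℂ)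
    have h2 : ‖hmem.toLp m‖ ≤ K := by
      rw [Lp.norm_toLp]
      exact ENNReal.toReal_le_of_le_ofReal hK
        (by simpa using eLpNormEssSup_le_of_ae_bound hb)
    calc _ ≤ 1 * K := mul_le_mul h1 h2 (norm_nonneg _) zero_le_one
      _ = K := one_mul K
  · rw [ContinuousLinearMap.holderL_apply_apply]
    filter_upwards [ContinuousLinearMap.coeFn_holder (r := 2) (ContinuousLinearMap.mul ℂ ℂ)
      (hmem.toLp m) h, hmem.coeFn_toLp] with t h1 h2
    rw [h1, h2]
    rfl

/-- On `L¹ ∩ L²` the Fourier transform on `L²` is given by the Fourier integral. -/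
theorem fourier_toLp_ae_eq {f : ℝ → ℂ} (h1 : Integrable f) (h2 : MemLp f 2) :
    (𝓕 (h2.toLp f) : Lp ℂ 2 (volume : Measure ℝ)) =ᵐ[volume] 𝓕 f := by
  have hcont : Continuous (𝓕 f) :=
    VectorFourier.fourierIntegral_continuous Real.continuous_fourierChar
      (by exact continuous_inner) h1
  -- Both sides are tested against smooth compactly supported functions, regarded as Schwartz
  -- functions. The `L²` transform agrees with the distributional one, and for integrable `f` the
  -- transform moves to the test function by Fubini.
  refine ae_eq_of_integral_contDiff_smul_eq ((Lp.memLp _).locallyIntegrable (by norm_num))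
    hcont.locallyIntegrable fun g hg hgs => ?_
  have hg₁ : HasCompactSupport (Complex.ofRealCLM ∘ g) := hgs.comp_left rfl
  have hg₂ : ContDiff ℝ ((⊤ : ℕ∞) : WithTop ℕ∞) (Complex.ofRealCLM ∘ g) := by fun_prop
  set φ : 𝓢(ℝ, ℂ) := hg₁.toSchwartzMap hg₂
  have hφ : ∀ x, φ x = (g x : ℂ) := fun x => rfl
  have e1 := congrArg (fun T => T φ) (Lp.fourier_toTemperedDistribution_eq (h2.toLp f))
  simp only [TemperedDistribution.fourier_apply, Lp.toTemperedDistribution_apply] at e1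
  have e2 : ∫ x, (𝓕 φ) x • f x = ∫ x, φ x • 𝓕 f x := by
    have := VectorFourier.integral_fourierIntegral_smul_eq_flip (L := innerₗ ℝ)
      Real.continuous_fourierChar continuous_inner (φ.integrable (μ := volume)) h1
    rw [flip_innerₗ] at this
    rw [SchwartzMap.fourier_coe]
    exact this
  have e3 : ∫ x, (𝓕 φ) x • (h2.toLp f) x = ∫ x, (𝓕 φ) x • f x := by
    refine integral_congr_ae ?_
    filter_upwards [h2.coeFn_toLp] with x hx
    rw [hx]
  simp only [hφ, Complex.coe_smul] at e1 e2
  rw [← e1, e3, e2]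

/-- The symbol is `∓2πi exp(-2πat)` cut off to the half-line on which it decays, hence the case
split on the sign of `a`. Its supremum bound `2π` does not involve `a`, which is what allows the
lines to approach each other later. -/
theorem exists_cauchy_symbol {a : ℝ} (ha : a ≠ 0) :
    ∃ m : ℝ → ℂ, Integrable m ∧ (∀ t, ‖m t‖ ≤ 2 * Real.pi) ∧
      ∀ u : ℝ, ∫ t, m t * Complex.exp (2 * Real.pi * Complex.I * u * t) =
        ((u : ℂ) + a * Complex.I)⁻¹ := by
  have hpi : (Real.pi : ℂ) ≠ 0 := by exact_mod_cast Real.pi_ne_zero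
  have hu : ∀ u : ℝ, (u : ℂ) + a * Complex.I ≠ 0 := fun u h => ha (by simpa using congrArg Complex.im h)
  have hc : ∀ u : ℝ, (-(2 * Real.pi * a : ℝ) : ℂ) + 2 * Real.pi * Complex.I * u =
      2 * Real.pi * Complex.I * (u + a * Complex.I) := by
    intro u
    push_cast
    linear_combination (-2 * (Real.pi : ℂ) * a) * Complex.I_sq
  have hexp : ∀ u t : ℝ, Complex.exp (-(2 * Real.pi * a : ℝ) * t) *
      Complex.exp (2 * Real.pi * Complex.I * u * t) =
      Complex.exp ((2 * Real.pi * Complex.I * (u + a * Complex.I)) * t) := by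
    intro u t
    rw [← hc, ← Complex.exp_add]
    ring_nf
  have hre : ∀ u : ℝ, (2 * Real.pi * Complex.I * (u + a * Complex.I)).re = -(2 * Real.pi * a) := by
    intro u
    rw [← hc]
    simp
  have hnorm : ∀ t : ℝ, 0 ≤ a * t → ‖Complex.exp (-(2 * Real.pi * a : ℝ) * t)‖ ≤ 1 := by
    intro t ht
    rw [Complex.norm_exp, Real.exp_le_one_iff]
    have := mul_nonneg Real.pi_pos.le ht
    simp
    nlinarith
  have hpi2 := Real.pi_pos
  rcases lt_or_gt_of_ne ha with ha' | ha'
  · refine ⟨(Iic 0).indicator fun t : ℝ => (2 * Real.pi * Complex.I) *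
      Complex.exp (-(2 * Real.pi * a : ℝ) * t), ?_, fun t => ?_, fun u => ?_⟩
    · rw [integrable_indicator_iff measurableSet_Iic]
      refine Integrable.const_mul (integrableOn_exp_mul_complex_Iic ?_ 0) _
      simp only [Complex.neg_re, Complex.ofReal_re]
      nlinarith
    · by_cases ht : t ∈ Iic (0 : ℝ)
      · rw [indicator_of_mem ht, norm_mul]
        have := hnorm t (mul_nonneg_of_nonpos_of_nonpos ha'.le ht)
        simpa [abs_of_pos hpi2] using mul_le_mul_of_nonneg_left this (by positivity : 0 ≤ 2 * Real.pi)
      · rw [indicator_of_notMem ht, norm_zero]; positivity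
    · have hind : ∀ t : ℝ, (Iic (0 : ℝ)).indicator (fun t : ℝ => (2 * Real.pi * Complex.I) *
          Complex.exp (-(2 * Real.pi * a : ℝ) * t)) t *
          Complex.exp (2 * Real.pi * Complex.I * u * t) =
          (Iic (0 : ℝ)).indicator (fun t : ℝ => (2 * Real.pi * Complex.I) *
          Complex.exp (-(2 * Real.pi * a : ℝ) * t) *
          Complex.exp (2 * Real.pi * Complex.I * u * t)) t :=
        fun t => by
          rw [← indicator_mul_left _ _ fun t : ℝ => Complex.exp (2 * Real.pi * Complex.I * u * t)]
      simp_rw [hind]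
      rw [integral_indicator measurableSet_Iic]
      simp_rw [mul_assoc _ (Complex.exp _), hexp]
      rw [integral_const_mul, integral_exp_mul_complex_Iic (by rw [hre]; nlinarith)]
      have := hu u
      have hI := Complex.I_ne_zero
      rw [Complex.ofReal_zero, mul_zero, Complex.exp_zero]
      field_simp
  · refine ⟨(Ioi 0).indicator fun t : ℝ => (-(2 * Real.pi * Complex.I)) *
      Complex.exp (-(2 * Real.pi * a : ℝ) * t), ?_, fun t => ?_, fun u => ?_⟩
    · rw [integrable_indicator_iff measurableSet_Ioi]
      refine Integrable.const_mul (integrableOn_exp_mul_complex_Ioi ?_ 0) _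
      simp only [Complex.neg_re, Complex.ofReal_re]
      nlinarith
    · by_cases ht : t ∈ Ioi (0 : ℝ)
      · rw [indicator_of_mem ht, norm_mul]
        have := hnorm t (mul_nonneg ha'.le (le_of_lt ht))
        simpa [abs_of_pos hpi2] using mul_le_mul_of_nonneg_left this (by positivity : 0 ≤ 2 * Real.pi)
      · rw [indicator_of_notMem ht, norm_zero]; positivity
    · have hind : ∀ t : ℝ, (Ioi (0 : ℝ)).indicator (fun t : ℝ => (-(2 * Real.pi * Complex.I)) *
          Complex.exp (-(2 * Real.pi * a : ℝ) * t)) t *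
          Complex.exp (2 * Real.pi * Complex.I * u * t) =
          (Ioi (0 : ℝ)).indicator (fun t : ℝ => (-(2 * Real.pi * Complex.I)) *
          Complex.exp (-(2 * Real.pi * a : ℝ) * t) *
          Complex.exp (2 * Real.pi * Complex.I * u * t)) t :=
        fun t => by
          rw [← indicator_mul_left _ _ fun t : ℝ => Complex.exp (2 * Real.pi * Complex.I * u * t)]
      simp_rw [hind]
      rw [integral_indicator measurableSet_Ioi]
      simp_rw [mul_assoc _ (Complex.exp _), hexp]
      rw [integral_const_mul, integral_exp_mul_complex_Ioi (by rw [hre]; nlinarith)]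
      have := hu u
      have hI := Complex.I_ne_zero
      rw [Complex.ofReal_zero, mul_zero, Complex.exp_zero]
      field_simp

/-- The Cauchy transform between parallel lines at distance `|a|` is bounded on `L²`, uniformly
in `a`. -/
theorem exists_cauchyTransform {a : ℝ} (ha : a ≠ 0) :
    ∃ C : Lp ℂ 2 (volume : Measure ℝ) →L[ℂ] Lp ℂ 2 (volume : Measure ℝ), ‖C‖ ≤ 2 * Real.pi ∧
      ∀ g : 𝓢(ℝ, ℂ), C (g.toLp 2) =ᵐ[volume]
        fun s : ℝ => ∫ r : ℝ, g r * ((r : ℂ) - s + a * Complex.I)⁻¹ := by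
  obtain ⟨m, hmi, hmb, hm⟩ := exists_cauchy_symbol ha
  obtain ⟨M, hMn, hM⟩ := exists_mulOp (μ := volume) hmi.aestronglyMeasurable
    (by positivity) (Filter.Eventually.of_forall hmb)
  let U := Lp.fourierTransformₗᵢ ℝ ℂ
  -- Multiplication by `m` is conjugated by the unitary Fourier transform, so the norm is at most
  -- `sup ‖m‖`; evaluating the symbol at `u = r - s` produces the Cauchy kernel.
  refine ⟨(U.toContinuousLinearEquiv.toContinuousLinearMap).comp
    (M.comp U.symm.toContinuousLinearEquiv.toContinuousLinearMap), ?_, fun g => ?_⟩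
  · refine ContinuousLinearMap.opNorm_le_bound _ (by positivity) fun h => ?_
    have h1 : ‖M (U.symm h)‖ ≤ 2 * Real.pi * ‖h‖ := by
      refine (M.le_of_opNorm_le hMn _).trans ?_
      rw [LinearIsometryEquiv.norm_map]
    simpa using h1
  · have hUg : U.symm (g.toLp 2) = (𝓕⁻ g).toLp 2 := SchwartzMap.toLp_fourierInv_eq g
    set G : 𝓢(ℝ, ℂ) := 𝓕⁻ g with hG
    have hae : M (G.toLp 2) =ᵐ[volume] fun t => m t * G t := by
      filter_upwards [hM (G.toLp 2), G.coeFn_toLp 2 volume] with t h1 h2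
      rw [h1, h2]
    have hf2 : MemLp (fun t => m t * G t) 2 volume := (memLp_congr_ae hae).1 (Lp.memLp _)
    have hf1 : Integrable (fun t => m t * G t) := by
      refine (G.integrable (μ := volume)).bdd_mul (c := 2 * Real.pi) hmi.aestronglyMeasurable
        (Filter.Eventually.of_forall hmb)
    have heq : M (G.toLp 2) = hf2.toLp _ := by
      refine Lp.ext (hae.trans hf2.coeFn_toLp.symm)
    have hfin : (U.toContinuousLinearEquiv.toContinuousLinearMap).comp
        (M.comp U.symm.toContinuousLinearEquiv.toContinuousLinearMap) (g.toLp 2) =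
        (𝓕 (hf2.toLp _) : Lp ℂ 2 (volume : Measure ℝ)) := by
      rw [← heq, ← hUg]
      rfl
    rw [hfin]
    refine (fourier_toLp_ae_eq hf1 hf2).trans (Filter.Eventually.of_forall fun s => ?_)
    have hGt : ∀ t, G t = ∫ r : ℝ, Complex.exp (2 * Real.pi * Complex.I * r * t) * g r := by
      intro t
      rw [hG, SchwartzMap.fourierInv_coe, Real.fourierInv_eq']
      refine integral_congr_ae (Filter.Eventually.of_forall fun r => ?_)
      simp only [smul_eq_mul]
      congr 2
      simp
      ring
    have hK : ∀ r : ℝ, ((r : ℂ) - s + a * Complex.I)⁻¹ =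
        ∫ t : ℝ, m t * Complex.exp (2 * Real.pi * Complex.I * (r - s) * t) := by
      intro r
      have := hm (r - s)
      push_cast at this
      exact this.symm
    have hint : Integrable (Function.uncurry fun t r : ℝ =>
        Complex.exp (2 * Real.pi * Complex.I * (r - s) * t) * (m t * g r))
        ((volume : Measure ℝ).prod volume) := by
      refine (hmi.mul_prod (g.integrable (μ := volume))).bdd_mul (c := 1)
        (Continuous.aestronglyMeasurable (by fun_prop)) (Filter.Eventually.of_forall fun p => ?_)
      rw [Complex.norm_exp, Real.exp_le_one_iff]
      simp
    show 𝓕 (fun t => m t * G t) s = _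
    rw [Real.fourier_eq']
    calc ∫ t : ℝ, Complex.exp (↑(-2 * Real.pi * inner ℝ t s) * Complex.I) • (m t * G t)
        = ∫ t : ℝ, ∫ r : ℝ, Complex.exp (2 * Real.pi * Complex.I * (r - s) * t) * (m t * g r) := by
          refine integral_congr_ae (Filter.Eventually.of_forall fun t => ?_)
          simp only [smul_eq_mul]
          rw [hGt, ← mul_assoc, ← integral_const_mul]
          refine integral_congr_ae (Filter.Eventually.of_forall fun r => ?_)
          have : Complex.exp (2 * Real.pi * Complex.I * (r - s) * t) =
              Complex.exp (↑(-2 * Real.pi * inner ℝ t s) * Complex.I) *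
                Complex.exp (2 * Real.pi * Complex.I * r * t) := by
            rw [← Complex.exp_add]
            congr 1
            simp
            ring
          simp only [this]
          ring
      _ = ∫ r : ℝ, ∫ t : ℝ, Complex.exp (2 * Real.pi * Complex.I * (r - s) * t) * (m t * g r) :=
          integral_integral_swap hint
      _ = _ := by
          refine integral_congr_ae (Filter.Eventually.of_forall fun r => ?_)
          simp only []
          rw [hK, ← integral_const_mul]
          refine integral_congr_ae (Filter.Eventually.of_forall fun t => ?_)
          simp only []
          ring

end CauchyTransform

/-! ### Splitting `L²(Γ_ω)` into its two lines -/

section Lines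

/-- Extension by zero on `L²`. -/
theorem exists_extensionOp {Ω Ω' : Type*} [MeasurableSpace Ω] [MeasurableSpace Ω'] {μ : Measure Ω}
    {ν : Measure Ω'} {L : Set Ω} (hL : MeasurableSet L) {p : Ω → Ω'}
    (hp : MeasurePreserving p (μ.restrict L) ν) :
    ∃ E : Lp ℂ 2 ν →L[ℂ] Lp ℂ 2 μ, ‖E‖ ≤ 1 ∧ ∀ g, E g =ᵐ[μ] L.indicator fun z => g (p z) := by
  have hmem : ∀ g : Lp ℂ 2 ν, MemLp (L.indicator fun z => g (p z)) 2 μ := fun g =>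
    (memLp_indicator_iff_restrict hL).2 ((Lp.memLp g).comp_measurePreserving hp)
  have hae : ∀ {u v : Ω' → ℂ}, u =ᵐ[ν] v →
      (L.indicator fun z => u (p z)) =ᵐ[μ] L.indicator fun z => v (p z) := fun h =>
    (ae_eq_restrict_iff_indicator_ae_eq hL).1 (hp.quasiMeasurePreserving.ae_eq_comp h)
  let E : Lp ℂ 2 ν →ₗ[ℂ] Lp ℂ 2 μ :=
    { toFun := fun g => (hmem g).toLp _
      map_add' := fun g g' => by
        rw [← MemLp.toLp_add]
        refine (MemLp.toLp_eq_toLp_iff _ _).2 ((hae (Lp.coeFn_add g g')).trans ?_)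
        exact Filter.Eventually.of_forall fun z => by
          by_cases hz : z ∈ L <;> simp [hz]
      map_smul' := fun c g => by
        rw [RingHom.id_apply, ← MemLp.toLp_const_smul]
        refine (MemLp.toLp_eq_toLp_iff _ _).2 ((hae (Lp.coeFn_smul c g)).trans ?_)
        exact Filter.Eventually.of_forall fun z => by
          by_cases hz : z ∈ L <;> simp [hz] }
  refine ⟨E.mkContinuous 1 fun g => ?_, E.mkContinuous_norm_le zero_le_one _,
    fun g => (hmem g).coeFn_toLp⟩
  change ‖(hmem g).toLp _‖ ≤ _
  rw [one_mul, Lp.norm_toLp, eLpNorm_indicator_eq_eLpNorm_restrict hL, Lp.norm_def]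
  exact (congrArg _ (eLpNorm_comp_measurePreserving (Lp.aestronglyMeasurable g) hp)).le

/-- Restriction on `L²`. -/
theorem exists_restrictionOp {Ω Ω' : Type*} [MeasurableSpace Ω] [MeasurableSpace Ω']
    {μ : Measure Ω} {ν : Measure Ω'} {L : Set Ω} {i : Ω' → Ω}
    (hi : MeasurePreserving i ν (μ.restrict L)) :
    ∃ P : Lp ℂ 2 μ →L[ℂ] Lp ℂ 2 ν, ‖P‖ ≤ 1 ∧ ∀ h, P h =ᵐ[ν] fun r => h (i r) := by
  have hmem : ∀ h : Lp ℂ 2 μ, MemLp (fun r => h (i r)) 2 ν := fun h =>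
    ((Lp.memLp h).restrict L).comp_measurePreserving hi
  have hae : ∀ {u v : Ω → ℂ}, u =ᵐ[μ] v → (fun r => u (i r)) =ᵐ[ν] fun r => v (i r) := fun h =>
    hi.quasiMeasurePreserving.ae_eq_comp (ae_restrict_of_ae h)
  let P : Lp ℂ 2 μ →ₗ[ℂ] Lp ℂ 2 ν :=
    { toFun := fun h => (hmem h).toLp _
      map_add' := fun g g' => by
        rw [← MemLp.toLp_add]
        exact (MemLp.toLp_eq_toLp_iff _ _).2 (hae (Lp.coeFn_add g g'))
      map_smul' := fun c g => by
        rw [RingHom.id_apply, ← MemLp.toLp_const_smul]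
        exact (MemLp.toLp_eq_toLp_iff _ _).2 (hae (Lp.coeFn_smul c g)) }
  refine ⟨P.mkContinuous 1 fun h => ?_, P.mkContinuous_norm_le zero_le_one _,
    fun h => (hmem h).coeFn_toLp⟩
  change ‖(hmem h).toLp _‖ ≤ _
  rw [one_mul, Lp.norm_toLp, Lp.norm_def]
  refine ENNReal.toReal_mono (Lp.eLpNorm_ne_top h) ?_
  exact (eLpNorm_comp_measurePreserving (Lp.aestronglyMeasurable h).restrict hi).le.trans
    (eLpNorm_mono_measure _ Measure.restrict_le_self)

theorem stripBoundaryMeasure_restrict {ω s : ℝ} (hω : 0 < ω) (hs : s = ω ∨ s = -ω) :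
    (stripBoundaryMeasure ω).restrict {z : ℂ | z.im = s} =
      (volume : Measure ℝ).map fun r : ℝ => (r : ℂ) + s * Complex.I := by
  have hL : MeasurableSet {z : ℂ | z.im = s} :=
    Complex.measurable_im (measurableSet_singleton s)
  have h1 : ∀ t : ℝ, Measurable fun r : ℝ => (r : ℂ) + t * Complex.I := fun t => by fun_prop
  have h2 : stripBoundaryMeasure ω =
      (volume : Measure ℝ).map (fun r : ℝ => (r : ℂ) + ω * Complex.I) +
      (volume : Measure ℝ).map (fun r : ℝ => (r : ℂ) + (-ω : ℝ) * Complex.I) := by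
    simp [stripBoundaryMeasure, sub_eq_add_neg]
  have h3 : ∀ t : ℝ, ((fun r : ℝ => (r : ℂ) + t * Complex.I) ⁻¹' {z : ℂ | z.im = s}) =
      {_r : ℝ | t = s} := by
    intro t; ext r; simp
  rw [h2, Measure.restrict_add, Measure.restrict_map (h1 _) hL, Measure.restrict_map (h1 _) hL,
    h3, h3]
  rcases hs with rfl | rfl
  · simp [show ¬ (-s = s) by intro h; linarith]
  · simp [show ¬ (ω = -ω) by intro h; linarith]

theorem ae_stripBoundaryMeasure (ω : ℝ) :
    ∀ᵐ z ∂(stripBoundaryMeasure ω), z.im = ω ∨ z.im = -ω := by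
  have hL : MeasurableSet {z : ℂ | z.im = ω ∨ z.im = -ω} :=
    (Complex.measurable_im (measurableSet_singleton ω)).union
      (Complex.measurable_im (measurableSet_singleton (-ω)))
  rw [stripBoundaryMeasure, ae_add_measure_iff]
  constructor
  · rw [ae_map_iff (by fun_prop) hL]; simp
  · rw [ae_map_iff (by fun_prop) hL]; simp

theorem measurePreserving_line {ω s : ℝ} (hω : 0 < ω) (hs : s = ω ∨ s = -ω) :
    MeasurePreserving (fun r : ℝ => (r : ℂ) + s * Complex.I) volume
      ((stripBoundaryMeasure ω).restrict {z : ℂ | z.im = s}) :=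
  ⟨by fun_prop, (stripBoundaryMeasure_restrict hω hs).symm⟩

theorem measurePreserving_re {ω s : ℝ} (hω : 0 < ω) (hs : s = ω ∨ s = -ω) :
    MeasurePreserving Complex.re ((stripBoundaryMeasure ω).restrict {z : ℂ | z.im = s})
      volume := by
  refine ⟨Complex.measurable_re, ?_⟩
  rw [stripBoundaryMeasure_restrict hω hs, Measure.map_map Complex.measurable_re (by fun_prop)]
  have h : (Complex.re ∘ fun r : ℝ => (r : ℂ) + s * Complex.I) = id := by
    funext r
    simp
  rw [h, Measure.map_id]

theorem measurableEmbedding_line (s : ℝ) :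
    MeasurableEmbedding fun r : ℝ => (r : ℂ) + s * Complex.I := by
  have : Topology.IsClosedEmbedding fun r : ℝ => (r : ℂ) + s * Complex.I := by
    refine (Isometry.isClosedEmbedding ?_)
    refine Isometry.of_dist_eq fun a b => ?_
    rw [dist_add_right, Complex.dist_eq, ← Complex.ofReal_sub, Complex.norm_real]
    rfl
  exact this.measurableEmbedding

/-- `L²(Γ_ω)` splits as the sum of the `L²` spaces of the two lines. -/
theorem exists_lineOps {ω : ℝ} (hω : 0 < ω) :
    ∃ (E : ℝ → Lp ℂ 2 (volume : Measure ℝ) →L[ℂ] Lp ℂ 2 (stripBoundaryMeasure ω))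
      (P : ℝ → Lp ℂ 2 (stripBoundaryMeasure ω) →L[ℂ] Lp ℂ 2 (volume : Measure ℝ)),
      (∀ s, s = ω ∨ s = -ω → ‖E s‖ ≤ 1 ∧ ‖P s‖ ≤ 1 ∧ ∀ (g : Lp ℂ 2 (volume : Measure ℝ)) (k : ℂ → ℂ),
        ∫ z, E s g z * k z ∂(stripBoundaryMeasure ω) = ∫ r, g r * k (r + s * Complex.I)) ∧
      ∀ h, E ω (P ω h) + E (-ω) (P (-ω) h) = h := by
  have hL : ∀ s : ℝ, MeasurableSet {z : ℂ | z.im = s} := fun s =>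
    Complex.measurable_im (measurableSet_singleton s)
  have hEx : ∀ s : ℝ, ∃ E : Lp ℂ 2 (volume : Measure ℝ) →L[ℂ] Lp ℂ 2 (stripBoundaryMeasure ω),
      s = ω ∨ s = -ω → ‖E‖ ≤ 1 ∧ ∀ g, E g =ᵐ[stripBoundaryMeasure ω]
        {z : ℂ | z.im = s}.indicator fun z => g z.re := by
    intro s
    by_cases hs : s = ω ∨ s = -ω
    · obtain ⟨E, h⟩ := exists_extensionOp (hL s) (measurePreserving_re hω hs)
      exact ⟨E, fun _ => h⟩
    -- The operators are indexed by all heights; zero is a filler at heights other than `±ω`.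
    · exact ⟨0, fun h => absurd h hs⟩
  have hPx : ∀ s : ℝ, ∃ P : Lp ℂ 2 (stripBoundaryMeasure ω) →L[ℂ] Lp ℂ 2 (volume : Measure ℝ),
      s = ω ∨ s = -ω → ‖P‖ ≤ 1 ∧ ∀ h, P h =ᵐ[volume] fun r : ℝ => h (r + s * Complex.I) := by
    intro s
    by_cases hs : s = ω ∨ s = -ω
    · obtain ⟨P, h⟩ := exists_restrictionOp (measurePreserving_line hω hs)
      exact ⟨P, fun _ => h⟩
    · exact ⟨0, fun h => absurd h hs⟩
  choose E hE using hEx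
  choose P hP using hPx
  refine ⟨E, P, fun s hs => ⟨(hE s hs).1, (hP s hs).1, fun g k => ?_⟩, fun h => ?_⟩
  · have h1 : ∫ z, E s g z * k z ∂(stripBoundaryMeasure ω) =
        ∫ z, {z : ℂ | z.im = s}.indicator (fun z => g z.re * k z) z ∂(stripBoundaryMeasure ω) := by
      refine integral_congr_ae ?_
      filter_upwards [(hE s hs).2 g] with z hz
      rw [hz, ← indicator_mul_left _ _ fun z => k z]
    rw [h1, integral_indicator (hL s), stripBoundaryMeasure_restrict hω hs,
      (measurableEmbedding_line s).integral_map]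
    simp
  · have key : ∀ s, s = ω ∨ s = -ω → E s (P s h) =ᵐ[stripBoundaryMeasure ω]
        {z : ℂ | z.im = s}.indicator fun z => h z := by
      intro s hs
      refine ((hE s hs).2 _).trans ((ae_eq_restrict_iff_indicator_ae_eq (hL s)).1 ?_)
      have h1 := (measurePreserving_re hω hs).quasiMeasurePreserving.ae_eq_comp ((hP s hs).2 h)
      filter_upwards [h1, ae_restrict_mem (hL s)] with z hz hz2
      simp only [Function.comp_apply] at hz
      rw [hz]
      congr 1
      rw [← show z.im = s from hz2, Complex.re_add_im]
    refine Lp.ext ((Lp.coeFn_add _ _).trans ?_)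
    filter_upwards [key ω (Or.inl rfl), key (-ω) (Or.inr rfl), ae_stripBoundaryMeasure ω]
      with z h1 h2 h3
    rw [Pi.add_apply, h1, h2]
    rcases h3 with h3 | h3
    · have : ω ≠ -ω := by intro h; linarith
      simp [h3, this]
    · have : -ω ≠ ω := by intro h; linarith
      simp [h3, this]

end Lines

/-! ### From the orbit of `x` to the orbit of `F(A)x` -/

section Transference

open scoped SchwartzMap

/-- Strong convergence of bounded sequences of operators may be checked on a dense set. -/
theorem tendsto_of_denseRange {ι E X : Type*} [NormedAddCommGroup E] [NormedSpace ℂ E]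
    [NormedAddCommGroup X] [NormedSpace ℂ X] {T : ℕ → E →L[ℂ] X} {T' : E →L[ℂ] X} {K : ℝ}
    (hT : ∀ k, ‖T k‖ ≤ K) {d : ι → E} (hd : DenseRange d)
    (h : ∀ i, Filter.Tendsto (fun k => T k (d i)) Filter.atTop (nhds (T' (d i)))) (x : E) :
    Filter.Tendsto (fun k => T k x) Filter.atTop (nhds (T' x)) := by
  have hK : 0 ≤ K := (norm_nonneg _).trans (hT 0)
  rw [Metric.tendsto_atTop]
  intro ε hε
  have hpos : 0 < ε / (2 * (K + ‖T'‖ + 1)) := by positivity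
  obtain ⟨i, hi⟩ := hd.exists_dist_lt x hpos
  obtain ⟨n, hn⟩ := Metric.tendsto_atTop.1 (h i) (ε / 2) (by positivity)
  refine ⟨n, fun k hk => ?_⟩
  have h1 := hn k hk
  rw [dist_eq_norm] at h1 hi ⊢
  have h2 : T k x - T' x = T k (x - d i) + (T k (d i) - T' (d i)) - T' (x - d i) := by
    simp only [map_sub]; abel
  have h3 : ‖T k (x - d i)‖ ≤ K * ‖x - d i‖ := (T k).le_of_opNorm_le (hT k) _
  have h4 : ‖T' (x - d i)‖ ≤ ‖T'‖ * ‖x - d i‖ := T'.le_opNorm _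
  have h5 : (K + ‖T'‖ + 1) * ‖x - d i‖ < ε / 2 := by
    rw [lt_div_iff₀ (by positivity)] at hi
    linarith
  have h6 := norm_sub_le (T k (x - d i) + (T k (d i) - T' (d i))) (T' (x - d i))
  have h7 := norm_add_le (T k (x - d i)) (T k (d i) - T' (d i))
  have h8 := norm_nonneg (x - d i)
  rw [h2]
  linarith

variable {X : Type*} [NormedAddCommGroup X] [NormedSpace ℂ X] [CompleteSpace X]
  {A : X →ₗ.[ℂ] X} {α : ℝ}

/-- Fubini's theorem: since `θ ≠ σ`, the kernel is bounded by `|θ - σ|⁻¹`, and `g` and the weighted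
orbit are integrable. The integrability claim is needed to subtract the contributions of the two
lines. -/
theorem IsStripType.line_operator_apply (hA : IsStripType A α) {ω ω' : ℝ} {F : ℂ → ℂ}
    (hF : IsGaussianDecaying ω' F) (hω : α < ω) (hω' : ω < ω') {σ θ : ℝ} (hσ : σ = ω ∨ σ = -ω)
    (hθ : ω < |θ|) (x : X) (φ : X →L[ℂ] ℂ) (g : 𝓢(ℝ, ℂ)) :
    Integrable (fun r : ℝ => g r * φ (∫ s : ℝ, (F (s + σ * Complex.I) /
        (r + θ * Complex.I - (s + σ * Complex.I))) • res A (s + σ * Complex.I) x)) ∧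
      ∫ s : ℝ, (F (s + σ * Complex.I) *
          ∫ r : ℝ, g r * ((r : ℂ) - s + (θ - σ : ℝ) * Complex.I)⁻¹) *
            φ (res A (s + σ * Complex.I) x) =
        ∫ r : ℝ, g r * φ (∫ s : ℝ, (F (s + σ * Complex.I) /
          (r + θ * Complex.I - (s + σ * Complex.I))) • res A (s + σ * Complex.I) x) := by
  have h0 : 0 < ω := hA.nonneg.trans_lt hω
  have hσ' : |σ| = ω := by rcases hσ with rfl | rfl <;> simp [abs_of_pos h0]
  have hne : θ - σ ≠ 0 := by
    intro h
    rw [sub_eq_zero.1 h, hσ'] at hθ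
    exact lt_irrefl _ hθ
  have hk : ∀ r s : ℝ, |θ - σ| ≤ ‖(r : ℂ) - s + (θ - σ : ℝ) * Complex.I‖ := by
    intro r s
    have := Complex.abs_im_le_norm ((r : ℂ) - s + (θ - σ : ℝ) * Complex.I)
    simpa using this
  have hk0 : ∀ r s : ℝ, (r : ℂ) - s + (θ - σ : ℝ) * Complex.I ≠ 0 := fun r s =>
    norm_pos_iff.1 ((abs_pos.2 hne).trans_le (hk r s))
  have hker : ∀ r s : ℝ, (r : ℂ) + θ * Complex.I - (s + σ * Complex.I) =
      (r : ℂ) - s + (θ - σ : ℝ) * Complex.I := by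
    intro r s; push_cast; ring
  simp_rw [hker]
  have hFi := hF.integrable_line (s := σ) (by rw [hσ']; exact hω')
  obtain ⟨M, hM0, hM⟩ := hA.exists_bound hω
  have hRc := hA.continuous_res_line (s := σ) (by rw [hσ']; exact hω)
  have hRx : Continuous fun s : ℝ => res A (s + σ * Complex.I) x := hRc.clm_apply continuous_const
  have hinv : Continuous fun p : ℝ × ℝ =>
      ((p.1 : ℂ) - p.2 + (θ - σ : ℝ) * Complex.I)⁻¹ :=
    Continuous.inv₀ (by fun_prop) fun p => hk0 p.1 p.2
  have hi1 : Integrable fun s : ℝ => F (s + σ * Complex.I) * φ (res A (s + σ * Complex.I) x) := by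
    refine hFi.mul_bdd (c := ‖φ‖ * (M * ‖x‖)) (φ.continuous.comp hRx).aestronglyMeasurable
      (Filter.Eventually.of_forall fun s => ?_)
    refine (φ.le_opNorm _).trans ?_
    gcongr
    exact (res A _).le_of_opNorm_le (hM _ (by simp [hσ'])) x
  have hi2 : Integrable (Function.uncurry fun r s : ℝ =>
      ((r : ℂ) - s + (θ - σ : ℝ) * Complex.I)⁻¹ *
        (g r * (F (s + σ * Complex.I) * φ (res A (s + σ * Complex.I) x))))
      ((volume : Measure ℝ).prod volume) := by
    refine ((g.integrable (μ := volume)).mul_prod hi1).bdd_mul (c := |θ - σ|⁻¹)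
      hinv.aestronglyMeasurable (Filter.Eventually.of_forall fun p => ?_)
    rw [norm_inv]
    exact inv_anti₀ (abs_pos.2 hne) (hk p.1 p.2)
  have hV : ∀ r : ℝ, g r * φ (∫ s : ℝ, (F (s + σ * Complex.I) /
      ((r : ℂ) - s + (θ - σ : ℝ) * Complex.I)) • res A (s + σ * Complex.I) x) =
      ∫ s : ℝ, ((r : ℂ) - s + (θ - σ : ℝ) * Complex.I)⁻¹ *
        (g r * (F (s + σ * Complex.I) * φ (res A (s + σ * Complex.I) x))) := by
    intro r
    have hi3 : Integrable fun s : ℝ => (F (s + σ * Complex.I) /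
      ((r : ℂ) - s + (θ - σ : ℝ) * Complex.I)) • res A (s + σ * Complex.I) x := by
      have hq : Integrable fun s : ℝ => F (s + σ * Complex.I) /
          ((r : ℂ) - s + (θ - σ : ℝ) * Complex.I) := by
        simp_rw [div_eq_mul_inv]
        refine hFi.mul_bdd (c := |θ - σ|⁻¹)
          (hinv.comp (by fun_prop : Continuous fun s : ℝ => (r, s))).aestronglyMeasurable
          (Filter.Eventually.of_forall fun s => ?_)
        rw [norm_inv]
        exact inv_anti₀ (abs_pos.2 hne) (hk r s)
      exact (hA.integrable_smul_res (s := σ) (by rw [hσ']; exact hω) hq).apply_continuousLinearMap x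
    rw [← φ.integral_comp_comm hi3, ← integral_const_mul]
    refine integral_congr_ae (Filter.Eventually.of_forall fun s => ?_)
    simp only [map_smul, smul_eq_mul]
    ring
  simp_rw [hV]
  refine ⟨hi2.integral_prod_left, ?_⟩
  rw [integral_integral_swap hi2]
  refine integral_congr_ae (Filter.Eventually.of_forall fun s => ?_)
  simp only []
  rw [mul_right_comm, ← integral_const_mul]
  refine integral_congr_ae (Filter.Eventually.of_forall fun r => ?_)
  simp only []
  ring

/-- The resolvent orbit of `F(A) x` on a line outside of the closed strip is obtained from the
resolvent orbit of `x` on `Γ_ω` by a uniformly bounded operator. -/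
theorem IsStripType.exists_transference (hA : IsStripType A α) {ω ω' : ℝ} {F : ℂ → ℂ}
    (hF : IsGaussianDecaying ω' F) (hω : α < ω) (hω' : ω < ω') {N : ℝ} (hN : 0 ≤ N)
    (hFN : ∀ z ∈ strip ω', ‖F z‖ ≤ N) {θ : ℝ} (hθ : ω < |θ|) (x : X)
    {J : Lp ℂ 2 (stripBoundaryMeasure ω) →L[ℂ] X}
    (hJ : IsPettisOperator (fun z => res A z x) (stripBoundaryMeasure ω) J) :
    ∃ D : Lp ℂ 2 (volume : Measure ℝ) →L[ℂ] Lp ℂ 2 (stripBoundaryMeasure ω), ‖D‖ ≤ 2 * N ∧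
      ∀ g : 𝓢(ℝ, ℂ), J (D (g.toLp 2)) =
        ∫ r : ℝ, g r • res A (r + θ * Complex.I) (contourCalc A ω F x) := by
  have h0 : 0 < ω := hA.nonneg.trans_lt hω
  obtain ⟨E, P, hEP, -⟩ := exists_lineOps h0
  have hpart : ∀ σ : ℝ, σ = ω ∨ σ = -ω →
      ∃ D : Lp ℂ 2 (volume : Measure ℝ) →L[ℂ] Lp ℂ 2 (stripBoundaryMeasure ω),
        ‖D‖ ≤ 2 * Real.pi * N ∧ ∀ (g : 𝓢(ℝ, ℂ)) (φ : X →L[ℂ] ℂ), φ (J (D (g.toLp 2))) =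
          ∫ r : ℝ, g r * φ (∫ s : ℝ, (F (s + σ * Complex.I) /
            (r + θ * Complex.I - (s + σ * Complex.I))) • res A (s + σ * Complex.I) x) := by
    intro σ hσ
    have hσ' : |σ| = ω := by rcases hσ with rfl | rfl <;> simp [abs_of_pos h0]
    have hne : θ - σ ≠ 0 := by
      intro h
      rw [sub_eq_zero.1 h, hσ'] at hθ
      exact lt_irrefl _ hθ
    obtain ⟨C, hCn, hC⟩ := exists_cauchyTransform hne
    obtain ⟨M, hMn, hM⟩ := exists_mulOp (μ := volume)
      (hF.continuous_line (s := σ) (by rw [hσ']; exact hω')).aestronglyMeasurable hN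
      (Filter.Eventually.of_forall fun r => hFN _ (by simpa [strip, hσ'] using hω'))
    obtain ⟨hEn, -, hEi⟩ := hEP σ hσ
    -- Seen from the test function `g`, the operators act in transposed order: Cauchy transform,
    -- multiplication by `F`, then placement on the line of height `σ`.
    refine ⟨(E σ).comp (M.comp C), ?_, fun g φ => ?_⟩
    · calc ‖(E σ).comp (M.comp C)‖ ≤ ‖E σ‖ * (‖M‖ * ‖C‖) :=
            (ContinuousLinearMap.opNorm_comp_le _ _).trans
              (mul_le_mul_of_nonneg_left (ContinuousLinearMap.opNorm_comp_le _ _) (norm_nonneg _))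
        _ ≤ 1 * (N * (2 * Real.pi)) := by gcongr
        _ = _ := by ring
    · rw [hJ, ContinuousLinearMap.comp_apply, ContinuousLinearMap.comp_apply,
        hEi _ fun z => φ (res A z x), ← (hA.line_operator_apply hF hω hω' hσ hθ x φ g).2]
      refine integral_congr_ae ?_
      filter_upwards [hM (C (g.toLp 2)), hC g] with s h1 h2
      rw [h1, h2]
  obtain ⟨D₁, hD₁, hJ₁⟩ := hpart (-ω) (Or.inr rfl)
  obtain ⟨D₂, hD₂, hJ₂⟩ := hpart ω (Or.inl rfl)
  -- The signs are those of the orientation in `contourCalc`. The prefactor cancels the `2π` of the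
  -- Cauchy transforms, so the two lines together cost `2N`.
  refine ⟨(2 * (Real.pi : ℂ) * Complex.I)⁻¹ • (D₁ - D₂), ?_, fun g => ?_⟩
  · rw [norm_smul]
    have h1 : ‖(2 * (Real.pi : ℂ) * Complex.I)⁻¹‖ = (2 * Real.pi)⁻¹ := by
      simp [abs_of_pos Real.pi_pos]
    have hpi := Real.pi_pos
    rw [h1, inv_mul_le_iff₀ (by positivity)]
    have := norm_sub_le D₁ D₂
    nlinarith
  · refine (SeparatingDual.eq_iff_forall_dual_eq (R := ℂ)).2 fun φ => ?_
    obtain ⟨M, hM0, hM⟩ := hA.exists_bound hω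
    have hint : Integrable fun r : ℝ =>
        g r • res A (r + θ * Complex.I) (contourCalc A ω F x) :=
      (hA.integrable_smul_res (s := θ) (hω.trans hθ)
        (g.integrable (μ := volume))).apply_continuousLinearMap _
    rw [← φ.integral_comp_comm hint, smul_apply, sub_apply, map_smul, map_sub, map_smul, map_sub,
      hJ₁, hJ₂, ← integral_sub (hA.line_operator_apply hF hω hω' (Or.inr rfl) hθ x φ g).1
        (hA.line_operator_apply hF hω hω' (Or.inl rfl) hθ x φ g).1, smul_eq_mul,
      ← integral_const_mul]
    refine integral_congr_ae (Filter.Eventually.of_forall fun r => ?_)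
    simp only []
    rw [hA.res_contourCalc hF hω hω' (l := r + θ * Complex.I) (by simpa using hθ), map_smul,
      map_smul, map_sub]
    simp only [smul_eq_mul]
    ring

/-- On `Γ_ω` itself the Cauchy kernel is singular, so the orbit of `F(A)x` is approached from lines
outside the strip. The uniform operator bound passes to the limit although only strong convergence
is available. -/
theorem IsStripType.gammaNorm_contourCalc_le (hA : IsStripType A α) {ω ω' : ℝ} {F : ℂ → ℂ}
    (hF : IsGaussianDecaying ω' F) (hω : α < ω) (hω' : ω < ω') {N : ℝ} (hN : 0 ≤ N)
    (hFN : ∀ z ∈ strip ω', ‖F z‖ ≤ N) (x : X)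
    {J J' : Lp ℂ 2 (stripBoundaryMeasure ω) →L[ℂ] X}
    (hJ : IsPettisOperator (fun z => res A z x) (stripBoundaryMeasure ω) J)
    (hJ' : IsPettisOperator (fun z => res A z (contourCalc A ω F x)) (stripBoundaryMeasure ω) J') :
    gammaNorm J' ≤ ENNReal.ofReal (4 * N) * gammaNorm J := by
  have h0 : 0 < ω := hA.nonneg.trans_lt hω
  set y := contourCalc A ω F x with hy
  obtain ⟨E, P, hEP, hsum⟩ := exists_lineOps h0
  obtain ⟨M, hM0, hM⟩ := hA.exists_bound hω
  have hpart : ∀ σ : ℝ, σ = ω ∨ σ = -ω →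
      ∃ D : ℕ → Lp ℂ 2 (volume : Measure ℝ) →L[ℂ] Lp ℂ 2 (stripBoundaryMeasure ω),
        (∀ k, ‖D k‖ ≤ 2 * N) ∧ ∀ h, Filter.Tendsto (fun k => J (D k h)) Filter.atTop
          (nhds (J' (E σ h))) := by
    intro σ hσ
    have hσ' : |σ| = ω := by rcases hσ with rfl | rfl <;> simp [abs_of_pos h0]
    -- Heights with the sign of `σ`, tending to `σ` from outside the closed strip.
    let θ : ℕ → ℝ := fun k => (1 + 1 / ((k : ℝ) + 1)) * σ
    have hθ : ∀ k, ω < |θ k| := by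
      intro k
      have h1 : 0 < 1 / ((k : ℝ) + 1) := by positivity
      rw [abs_mul, hσ', abs_of_pos (by linarith)]
      nlinarith
    have hθlim : Filter.Tendsto θ Filter.atTop (nhds σ) := by
      have := (tendsto_one_div_add_atTop_nhds_zero_nat (𝕜 := ℝ)).const_add 1 |>.mul_const σ
      simpa [θ] using this
    choose D hDn hD using fun k => hA.exists_transference hF hω hω' hN hFN (hθ k) x hJ
    refine ⟨D, hDn, ?_⟩
    -- The operators are uniformly bounded, so convergence need only be checked on Schwartz
    -- functions, where dominated convergence applies.
    have hdense := SchwartzMap.denseRange_toLpCLM (E := ℝ) (F := ℂ) (p := 2) (μ := volume)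
      ENNReal.ofNat_ne_top
    refine tendsto_of_denseRange (T := fun k => J.comp (D k)) (T' := J'.comp (E σ))
      (K := ‖J‖ * (2 * N)) (fun k => ?_) hdense fun g => ?_
    · exact (ContinuousLinearMap.opNorm_comp_le _ _).trans
        (mul_le_mul_of_nonneg_left (hDn k) (norm_nonneg _))
    · have hgi := g.integrable (μ := volume)
      have hlim : J' (E σ (g.toLp 2)) = ∫ r : ℝ, g r • res A (r + σ * Complex.I) y := by
        refine (SeparatingDual.eq_iff_forall_dual_eq (R := ℂ)).2 fun φ => ?_
        have hint : Integrable fun r : ℝ => g r • res A (r + σ * Complex.I) y :=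
          (hA.integrable_smul_res (s := σ) (by rw [hσ']; exact hω)
            hgi).apply_continuousLinearMap _
        rw [hJ', (hEP σ hσ).2.2 _ fun z => φ (res A z y), ← φ.integral_comp_comm hint]
        refine integral_congr_ae ?_
        filter_upwards [g.coeFn_toLp 2 volume] with r hr
        rw [hr, map_smul, smul_eq_mul]
      have hgoal : Filter.Tendsto
          (fun k => ∫ r : ℝ, g r • res A (r + θ k * Complex.I) y) Filter.atTop
          (nhds (∫ r : ℝ, g r • res A (r + σ * Complex.I) y)) := by
        refine tendsto_integral_of_dominated_convergence (fun r => ‖g r‖ * (M * ‖y‖))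
          (fun k => ?_) (hgi.norm.mul_const _) (fun k => Filter.Eventually.of_forall fun r => ?_)
          (Filter.Eventually.of_forall fun r => ?_)
        · exact ((hA.integrable_smul_res (s := θ k) (hω.trans (hθ k))
            hgi).apply_continuousLinearMap y).aestronglyMeasurable
        · rw [norm_smul]
          gcongr
          exact (res A _).le_of_opNorm_le (hM _ (by simpa using (hθ k).le)) y
        · have h1 : ContinuousAt (res A) (r + σ * Complex.I) :=
            hA.continuousAt_res (by simpa [hσ'] using hω)
          have h2 : Filter.Tendsto (fun k => (r : ℂ) + θ k * Complex.I) Filter.atTop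
              (nhds (r + σ * Complex.I)) :=
            ((Complex.continuous_ofReal.tendsto σ).comp hθlim |>.mul_const _).const_add _
          exact (((ContinuousLinearMap.apply ℂ X y).continuous.tendsto _).comp
            (h1.tendsto.comp h2)).const_smul _
      have h3 : ∀ k, J.comp (D k) (g.toLp 2) = ∫ r : ℝ, g r • res A (r + θ k * Complex.I) y :=
        fun k => hD k g
      simp only [SchwartzMap.toLpCLM_apply, h3, ContinuousLinearMap.comp_apply, hlim]
      exact hgoal
  obtain ⟨D₁, hD₁, hl₁⟩ := hpart ω (Or.inl rfl)
  obtain ⟨D₂, hD₂, hl₂⟩ := hpart (-ω) (Or.inr rfl)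
  -- Each target line contributes `2N`, whence the constant `4N`; `J (S k h)` tends to `J' h`
  -- because `h` is the sum of its two line components.
  let S : ℕ → Lp ℂ 2 (stripBoundaryMeasure ω) →L[ℂ] Lp ℂ 2 (stripBoundaryMeasure ω) :=
    fun k => (D₁ k).comp (P ω) + (D₂ k).comp (P (-ω))
  have hS : ∀ k, ‖S k‖ ≤ 4 * N := by
    intro k
    have h1 : ‖(D₁ k).comp (P ω)‖ ≤ 2 * N * 1 :=
      (ContinuousLinearMap.opNorm_comp_le _ _).trans
        (mul_le_mul (hD₁ k) (hEP ω (Or.inl rfl)).2.1 (norm_nonneg _) (by positivity))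
    have h2 : ‖(D₂ k).comp (P (-ω))‖ ≤ 2 * N * 1 :=
      (ContinuousLinearMap.opNorm_comp_le _ _).trans
        (mul_le_mul (hD₂ k) (hEP (-ω) (Or.inr rfl)).2.1 (norm_nonneg _) (by positivity))
    have := norm_add_le ((D₁ k).comp (P ω)) ((D₂ k).comp (P (-ω)))
    linarith
  refine iSup_le fun n => iSup₂_le fun e he => ?_
  refine gaussianSumNorm_le_of_tendsto (x := fun k i => J (S k (e i))) (fun i => ?_)
    fun k => gaussianSumNorm_comp_le (S k) J (hS k) he
  have h1 := (hl₁ (P ω (e i))).add (hl₂ (P (-ω) (e i)))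
  rw [← map_add, hsum] at h1
  refine h1.congr fun k => ?_
  simp [S]

end Transference

/-! ### Approximating elementary functions by Gaussian-decaying ones on larger strips -/

section Approximation

variable {X : Type*} [NormedAddCommGroup X] [NormedSpace ℂ X] {A : X →ₗ.[ℂ] X} {α : ℝ}

theorem norm_exp_neg_sq_div (z : ℂ) (n : ℕ) :
    ‖Complex.exp (-z ^ 2 / ((n : ℂ) + 1))‖ =
      Real.exp (z.im ^ 2 / ((n : ℝ) + 1)) * Real.exp (-(z.re ^ 2 / ((n : ℝ) + 1))) := by
  rw [Complex.norm_exp, ← Real.exp_add]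
  congr 1
  have h : -z ^ 2 / ((n : ℂ) + 1) = -z ^ 2 / (((n : ℝ) + 1 : ℝ) : ℂ) := by push_cast; rfl
  rw [h, Complex.div_ofReal_re, sq z]
  simp
  ring

/-- The regularization `z ↦ f(z / s) exp(-(z / s)² / (n + 1))`. -/
noncomputable def regularization (f : ℂ → ℂ) (s : ℝ) (n : ℕ) (z : ℂ) : ℂ :=
  f (z / s) * Complex.exp (-(z / s) ^ 2 / ((n : ℂ) + 1))

theorem IsElementary.norm_le {ω : ℝ} {f : ℂ → ℂ} (hf : IsElementary ω f) {z : ℂ}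
    (hz : z ∈ strip ω) : ‖f z‖ ≤ hinfNorm ω f :=
  le_csSup hf.bdd ⟨z, hz, rfl⟩

theorem div_mem_strip {ω s : ℝ} (hs : 0 < s) {z : ℂ} (hz : z ∈ strip (s * ω)) :
    z / s ∈ strip ω := by
  simp only [strip, mem_ofPred_eq] at hz ⊢
  rwa [Complex.div_ofReal_im, abs_div, abs_of_pos hs, div_lt_iff₀ hs, mul_comm]

/-- On the undilated strip the Gaussian factor exceeds `1` only through the imaginary part, by at
most `exp (ω² / (n + 1))`. This tends to `1` and is lost in the limit. -/
theorem IsElementary.norm_regularization_le {ω : ℝ} {f : ℂ → ℂ} (hf : IsElementary ω f) {s : ℝ}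
    (hs : 0 < s) (n : ℕ) {z : ℂ} (hz : z ∈ strip (s * ω)) :
    ‖regularization f s n z‖ ≤ hinfNorm ω f * Real.exp (ω ^ 2 / ((n : ℝ) + 1)) *
      Real.exp (-(1 / (s ^ 2 * ((n : ℝ) + 1))) * z.re ^ 2) := by
  have hz' := div_mem_strip hs hz
  have h0 : 0 ≤ hinfNorm ω f := (norm_nonneg _).trans (hf.norm_le hz')
  rw [regularization, norm_mul, norm_exp_neg_sq_div, mul_assoc]
  have h1 : (z / s).im ^ 2 ≤ ω ^ 2 := sq_le_sq.2 ((le_of_lt hz').trans (le_abs_self ω))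
  have h2 : -((z / s).re ^ 2 / ((n : ℝ) + 1)) = -(1 / (s ^ 2 * ((n : ℝ) + 1))) * z.re ^ 2 := by
    rw [Complex.div_ofReal_re]
    field_simp
  rw [h2]
  have h3 := hf.norm_le hz'
  gcongr

theorem IsElementary.isGaussianDecaying_regularization {ω : ℝ} {f : ℂ → ℂ}
    (hf : IsElementary ω f) (hω : 0 < ω) {s : ℝ} (hs : 0 < s) (n : ℕ) :
    IsGaussianDecaying (s * ω) (regularization f s n) := by
  refine ⟨fun z hz => ?_, _, 1 / (s ^ 2 * ((n : ℝ) + 1)), ?_, by positivity,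
    fun z hz => hf.norm_regularization_le hs n hz⟩
  · have h1 : DifferentiableAt ℂ f (z / s) :=
      hf.holo.differentiableAt ((isOpen_strip ω).mem_nhds (div_mem_strip hs hz))
    have h2 : DifferentiableAt ℂ (fun z : ℂ => z / s) z := by fun_prop
    have h3 : DifferentiableAt ℂ (fun z : ℂ => f (z / s)) z := h1.comp z h2
    have h4 : DifferentiableAt ℂ (fun z : ℂ => Complex.exp (-(z / s) ^ 2 / ((n : ℂ) + 1))) z := by
      fun_prop
    exact (h3.mul h4).differentiableWithinAt
  · exact mul_nonneg ((norm_nonneg _).trans (hf.norm_le (z := 0) (by simpa [strip] using hω)))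
      (Real.exp_pos _).le

/-- Dilating the line together with `f` lets a change of variables undo the dilation of `f`, so `f`
is only evaluated on the fixed line of height `σ`, where it is integrable. Only the resolvent keeps
a dilated argument, and it is continuous and bounded there. -/
theorem IsStripType.tendsto_integral_regularization (hA : IsStripType A α) {ω : ℝ} {f : ℂ → ℂ}
    (hf : IsElementary ω f) {σ : ℝ} (hσ : α < |σ|) (hσω : |σ| < ω) {s : ℕ → ℝ}
    (hs : ∀ n, 1 ≤ s n) (hlim : Filter.Tendsto s Filter.atTop (nhds 1)) :
    Filter.Tendsto (fun n => ∫ r : ℝ, regularization f (s n) n (r + (s n * σ : ℝ) * Complex.I) •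
        res A (r + (s n * σ : ℝ) * Complex.I)) Filter.atTop
      (nhds (∫ r : ℝ, f (r + σ * Complex.I) • res A (r + σ * Complex.I))) := by
  have hs0 : ∀ n, 0 < s n := fun n => one_pos.trans_le (hs n)
  obtain ⟨M, hM0, hM⟩ := hA.exists_bound hσ
  have hsub : ∀ n, ∫ r : ℝ, regularization f (s n) n (r + (s n * σ : ℝ) * Complex.I) •
      res A (r + (s n * σ : ℝ) * Complex.I) =
      s n • ∫ r : ℝ, (f (r + σ * Complex.I) *
        Complex.exp (-(r + σ * Complex.I) ^ 2 / ((n : ℂ) + 1))) •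
          res A (s n * (r + σ * Complex.I)) := by
    intro n
    have h1 := Measure.integral_comp_mul_left (fun r : ℝ =>
      regularization f (s n) n (r + (s n * σ : ℝ) * Complex.I) •
        res A (r + (s n * σ : ℝ) * Complex.I)) (s n)
    rw [abs_of_pos (inv_pos.2 (hs0 n)), eq_inv_smul_iff₀ (hs0 n).ne'] at h1
    rw [← h1]
    congr 1
    refine integral_congr_ae (Filter.Eventually.of_forall fun r => ?_)
    have hne : (s n : ℂ) ≠ 0 := by exact_mod_cast (hs0 n).ne'
    have h2 : ((s n * r : ℝ) : ℂ) + (s n * σ : ℝ) * Complex.I = s n * (r + σ * Complex.I) := by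
      push_cast; ring
    simp only [h2, regularization, mul_div_cancel_left₀ _ hne]
  simp_rw [hsub]
  have hfi := hf.integrable σ hσω
  have hmain : Filter.Tendsto (fun n : ℕ => ∫ r : ℝ, (f (r + σ * Complex.I) *
        Complex.exp (-(r + σ * Complex.I) ^ 2 / ((n : ℂ) + 1))) •
          res A (s n * (r + σ * Complex.I))) Filter.atTop
      (nhds (∫ r : ℝ, f (r + σ * Complex.I) • res A (r + σ * Complex.I))) := by
    have him : ∀ n (r : ℝ), |σ| ≤ |((s n : ℂ) * (r + σ * Complex.I)).im| := by
      intro n r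
      have : ((s n : ℂ) * (r + σ * Complex.I)).im = s n * σ := by simp
      rw [this, abs_mul, abs_of_pos (hs0 n)]
      nlinarith [abs_nonneg σ, hs n]
    -- The factor `exp (σ²)` bounds the Gaussian on the line for every `n`, and `M` bounds the
    -- resolvent because `s n ≥ 1` moves points away from the real axis.
    refine tendsto_integral_of_dominated_convergence
      (fun r => ‖f (r + σ * Complex.I)‖ * Real.exp (σ ^ 2) * M) (fun n => ?_)
      ((hfi.norm.mul_const _).mul_const _) (fun n => Filter.Eventually.of_forall fun r => ?_)
      (Filter.Eventually.of_forall fun r => ?_)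
    · refine (hfi.aestronglyMeasurable.mul (Continuous.aestronglyMeasurable (by fun_prop))).smul
        (Continuous.aestronglyMeasurable ?_)
      refine continuous_iff_continuousAt.2 fun r => ?_
      have h1 : ContinuousAt (res A) (s n * (r + σ * Complex.I)) :=
        hA.continuousAt_res (hσ.trans_le (him n r))
      exact ContinuousAt.comp (f := fun r : ℝ => (s n : ℂ) * (r + σ * Complex.I)) h1 (by fun_prop)
    · rw [norm_smul, norm_mul, norm_exp_neg_sq_div]
      have h1 : Real.exp (((r : ℂ) + σ * Complex.I).im ^ 2 / ((n : ℝ) + 1)) ≤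
          Real.exp (σ ^ 2) := by
        rw [Real.exp_le_exp]
        simp only [Complex.add_im, Complex.ofReal_im, Complex.mul_im, Complex.ofReal_re,
          Complex.I_im, Complex.I_re, mul_one, mul_zero, add_zero, zero_add]
        exact div_le_self (sq_nonneg σ) (by linarith [(Nat.cast_nonneg n : (0 : ℝ) ≤ n)])
      have h2 : Real.exp (-(((r : ℂ) + σ * Complex.I).re ^ 2 / ((n : ℝ) + 1))) ≤ 1 := by
        rw [Real.exp_le_one_iff, neg_nonpos]
        positivity
      have h3 := mul_le_mul h1 h2 (Real.exp_pos _).le (Real.exp_pos _).le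
      rw [mul_one] at h3
      have h4 := hM _ (him n r)
      gcongr
    · have h1 : Filter.Tendsto (fun n : ℕ => ((n : ℂ) + 1)⁻¹) Filter.atTop (nhds 0) := by
        have := tendsto_one_div_add_atTop_nhds_zero_nat (𝕜 := ℂ)
        simpa using this
      have h2 : Filter.Tendsto (fun n : ℕ =>
          Complex.exp (-((r : ℂ) + σ * Complex.I) ^ 2 / ((n : ℂ) + 1))) Filter.atTop (nhds 1) := by
        have h3 := (Complex.continuous_exp.tendsto 0).comp
          (by simpa using h1.const_mul (-((r : ℂ) + σ * Complex.I) ^ 2) :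
            Filter.Tendsto (fun n : ℕ => -((r : ℂ) + σ * Complex.I) ^ 2 * ((n : ℂ) + 1)⁻¹)
              Filter.atTop (nhds 0))
        simpa [Function.comp_def, div_eq_mul_inv] using h3
      have h4 : Filter.Tendsto (fun n : ℕ => (s n : ℂ) * (r + σ * Complex.I)) Filter.atTop
          (nhds (r + σ * Complex.I)) := by
        have := ((Complex.continuous_ofReal.tendsto 1).comp hlim).mul_const (r + σ * Complex.I)
        simpa [Function.comp_def] using this
      have h5 : ContinuousAt (res A) (r + σ * Complex.I) :=
        hA.continuousAt_res (by simpa using hσ)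
      have h6 := (h2.const_mul (f (r + σ * Complex.I))).smul (h5.tendsto.comp h4)
      simpa using h6
  simpa using hlim.smul hmain

end Approximation

end StripCalculus

/-! ### Boundedness of the calculus -/

open StripCalculus in
theorem mainTheorem7 {X : Type*} [NormedAddCommGroup X] [NormedSpace ℂ X] [CompleteSpace X]
    (A : X →ₗ.[ℂ] X) (hdense : Dense (A.domain : Set X))
    (ω₀ ω : ℝ) (hA : IsStripType A ω₀) (hω : ω₀ < ω)
    (hmem : ∀ x : X, MemGamma (fun z => res A z x) (stripBoundaryMeasure ω))
    (hequiv : ∃ c C : ℝ, 0 < c ∧ 0 < C ∧ ∀ x : X,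
      ENNReal.ofReal (c * ‖x‖) ≤ gammaFunNorm (fun z => res A z x) (stripBoundaryMeasure ω) ∧
      gammaFunNorm (fun z => res A z x) (stripBoundaryMeasure ω) ≤ ENNReal.ofReal (C * ‖x‖)) :
    HasBoundedHinfCalculus A ω₀ ω := by
  obtain ⟨c, C, hc, hC, hcC⟩ := hequiv
  have h0 : 0 < ω := hA.nonneg.trans_lt hω
  -- The lower square function estimate is used at `F(A)x`, the upper one at `x`. The constant is
  -- independent of `ω'`.
  have key : ∀ (ω' : ℝ) (F : ℂ → ℂ) (N : ℝ), ω < ω' → 0 ≤ N → IsGaussianDecaying ω' F →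
      (∀ z ∈ strip ω', ‖F z‖ ≤ N) → ‖contourCalc A ω F‖ ≤ 4 * C / c * N := by
    intro ω' F N hω' hN hF hFN
    refine ContinuousLinearMap.opNorm_le_bound _ (by positivity) fun x => ?_
    set y := contourCalc A ω F x
    have h1 : ENNReal.ofReal (c * ‖y‖) ≤ ENNReal.ofReal (4 * N * (C * ‖x‖)) := by
      rw [ENNReal.ofReal_mul (p := 4 * N) (by positivity)]
      refine ((hcC y).1.trans (hA.gammaNorm_contourCalc_le hF hω hω' hN hFN x
        (pettisOperator_spec (hmem x).2.1) (pettisOperator_spec (hmem y).2.1))).trans ?_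
      gcongr
      exact (hcC x).2
    rw [ENNReal.ofReal_le_ofReal_iff (by positivity)] at h1
    rw [div_mul_eq_mul_div, div_mul_eq_mul_div, le_div_iff₀ hc]
    linarith
  refine ⟨4 * C / c, by positivity, fun f hf δ hδ hδω => ?_⟩
  have hδ0 : 0 < δ := hA.nonneg.trans_lt hδ
  have hN : 0 ≤ hinfNorm ω f :=
    (norm_nonneg _).trans (hf.norm_le (z := 0) (by simpa [strip] using h0))
  -- Chosen so that `s n > 1`, `s n → 1` and `s n * δ ≤ ω`, with equality at `n = 0`: the dilated
  -- contour can then be pushed outwards to `Γ_ω`, which lies inside the dilated strip.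
  let s : ℕ → ℝ := fun n => 1 + (ω - δ) / δ * (1 / ((n : ℝ) + 1))
  have hpos : ∀ n : ℕ, 0 < (ω - δ) / δ * (1 / ((n : ℝ) + 1)) := fun n =>
    mul_pos (div_pos (by linarith) hδ0) (by positivity)
  have hs1 : ∀ n, 1 < s n := fun n => by
    have := hpos n
    simp only [s]
    linarith
  have hsδ : ∀ n, s n * δ ≤ ω := fun n => by
    have h1 : 1 / ((n : ℝ) + 1) ≤ 1 :=
      (div_le_one (by positivity)).2 (by linarith [(Nat.cast_nonneg n : (0 : ℝ) ≤ n)])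
    have h2 : s n * δ = δ + (ω - δ) * (1 / ((n : ℝ) + 1)) := by
      simp only [s]
      field_simp
    rw [h2]
    nlinarith
  have hslim : Filter.Tendsto s Filter.atTop (nhds 1) := by
    have := ((tendsto_one_div_add_atTop_nhds_zero_nat (𝕜 := ℝ)).const_mul
      ((ω - δ) / δ)).const_add 1
    simpa [s] using this
  have habs : |δ| = δ := abs_of_pos hδ0
  have hlim : Filter.Tendsto (fun n => contourCalc A (s n * δ) (regularization f (s n) n))
      Filter.atTop (nhds (contourCalc A δ f)) := by
    simp_rw [contourCalc_eq_lines]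
    have h1 := hA.tendsto_integral_regularization hf (σ := -δ) (by rwa [abs_neg, habs])
      (by rwa [abs_neg, habs]) (fun n => (hs1 n).le) hslim
    have h2 := hA.tendsto_integral_regularization hf (σ := δ) (by rwa [habs])
      (by rwa [habs]) (fun n => (hs1 n).le) hslim
    simp_rw [mul_neg] at h1
    exact (h1.sub h2).const_smul _
  have hbound : ∀ n, ‖contourCalc A (s n * δ) (regularization f (s n) n)‖ ≤
      4 * C / c * (hinfNorm ω f * Real.exp (ω ^ 2 * (1 / ((n : ℝ) + 1)))) := by
    intro n
    have hs0 : 0 < s n := one_pos.trans (hs1 n)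
    have hsω : ω < s n * ω := by nlinarith [hs1 n]
    have hdec := hf.isGaussianDecaying_regularization h0 hs0 n
    -- The contour moves from height `s n * δ` to `ω`, where the square function estimate holds.
    rw [hA.contourCalc_eq hdec (by nlinarith [hs1 n]) (hsδ n) hsω]
    refine key _ _ _ hsω (by positivity) hdec fun z hz => ?_
    refine (hf.norm_regularization_le hs0 n hz).trans ?_
    rw [mul_one_div]
    refine mul_le_of_le_one_right (by positivity) ?_
    rw [Real.exp_le_one_iff, neg_mul, neg_nonpos]
    positivity
  have hblim : Filter.Tendsto (fun n : ℕ =>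
      4 * C / c * (hinfNorm ω f * Real.exp (ω ^ 2 * (1 / ((n : ℝ) + 1))))) Filter.atTop
      (nhds (4 * C / c * hinfNorm ω f)) := by
    have h1 := (Real.continuous_exp.tendsto _).comp
      ((tendsto_one_div_add_atTop_nhds_zero_nat (𝕜 := ℝ)).const_mul (ω ^ 2))
    have h2 := (h1.const_mul (hinfNorm ω f)).const_mul (4 * C / c)
    simpa [Function.comp_def] using h2
  exact le_of_tendsto_of_tendsto' hlim.norm hblim hbound
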